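/- Consider one access point and $N$ clients in slotted time $t=0,1,2,\dots$. Time is divided into periods $[k\tau,(k+1)\tau)$, $k\ge 0$, with $\tau\ge 1$. At the beginning of every period one packet arrives for each client; a packet not delivered within its period is dropped. In each slot the access point can make one transmission, and a transmission for client $n$ succeeds with probability $p_n\in(0,1]$, independently of the past. Let $a_n>0$ and $b_n\ge 0$ for $1\le n\le N$, and let $u_n(t)$ be the number of slots allocated to client $n$ before time $t$. A generalized transmission time policy with parameters $a,b$ sorts the clients at the beginning $t=k\tau$ of each period by $a_nu_n(t)-b_nt$ (ties are broken arbitrarily, on the basis of the information available at that time), and in every slot of the period it transmits the packet of the client that comes first in this order (smallest value first) among the clients whose packet is not yet delivered; it is idle only if all packets of the period are delivered. For $S\subseteq\{1,\dots,N\}$ let $I_S$ be the expected number of such forced idle slots in a period when only the clients in $S$ are present and served. Put $H_0=\emptyset$ and, as long as $H_{k-1}\ne\{1,\dots,N\}$, let $H_k$ be a maximal (with respect to inclusion) minimizer over all $S\supsetneq H_{k-1}$ of $$\Phi(H_{k-1},S)=\frac{\frac1\tau\,(I_{H_{k-1}}-I_S)-\sum_{n\in S\setminus H_{k-1}}\frac{b_n}{a_n}}{\sum_{n\in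 S\setminus H_{k-1}}\frac1{a_n}},\qquad \theta_k=\Phi(H_{k-1},H_k).$$ Then such sequences exist and every client lies in exactly one $H_k\setminus H_{k-1}$. The vector $q=(q_n)$ defined by $$q_n=\tau\,p_n\,\frac{b_n+\theta_k}{a_n}\qquad\text{for } n\in H_k\setminus H_{k-1}$$ does not depend on the choice of the sets $H_k$, and under every generalized transmission time policy with parameters $a,b$ the vector of long-term delivery ratios converges to $q$ with probability one: almost surely, for every $n$, the proportion of the first $K$ periods in which the packet of client $n$ is delivered converges to $q_n$ as $K\to\infty$. -/

import Mathlib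

open Filter Topology MeasureTheory ProbabilityTheory

namespace DelayQoS

variable {N : ℕ}

/-! ### One period of a fixed-priority schedule

Clients are `Fin N`.  A priority order is a permutation `r`, where `r n` is the rank of client `n`
(rank `0` is the highest priority).  `x s n` says whether a transmission for client `n` in the
`s`-th slot of the period would succeed. -/

/-- With undelivered set `U`, the slot is used for client `n`: its packet is undelivered and it has
the highest priority among the clients with an undelivered packet. -/
abbrev Served (r : Equiv.Perm (Fin N)) (U : Finset (Fin N)) (n : Fin N) : Prop :=
  n ∈ U ∧ ∀ m ∈ U, r n ≤ r m

/-- The clients whose packet is still undelivered after the first `s` slots of the period, when the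
packets present at the beginning of the period are those of the clients in `S`. -/
def pending (r : Equiv.Perm (Fin N)) (S : Finset (Fin N)) (x : ℕ → Fin N → Bool) :
    ℕ → Finset (Fin N)
  | 0 => S
  | s + 1 => (pending r S x s).filter
      (fun n => ¬ (Served r (pending r S x s) n ∧ x s n = true))

/-- Number of slots of a period of length `τ` that are spent on client `n`. -/
def workSlots (τ : ℕ) (r : Equiv.Perm (Fin N)) (S : Finset (Fin N)) (x : ℕ → Fin N → Bool)
    (n : Fin N) : ℕ :=
  ((Finset.range τ).filter (fun s => Served r (pending r S x s) n)).card

/-- Number of slots of a period of length `τ` in which the access point is forced to be idle. -/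
def idleSlots (τ : ℕ) (r : Equiv.Perm (Fin N)) (S : Finset (Fin N)) (x : ℕ → Fin N → Bool) : ℕ :=
  ((Finset.range τ).filter (fun s => pending r S x s = ∅)).card

/-- `I_S`: the expected number of forced idle slots in a period of length `τ` when only the clients
in `S` are served.  The expectation is over independent channel outcomes, a transmission for `n`
succeeding with probability `p n`.  The clients in `S` are served in the order of their numbers;
since the number of idle slots is `τ` minus the total number of transmissions that the clients in
`S` need (or `0`), its law does not depend on that order. -/
noncomputable def expectedIdle (τ : ℕ) (p : Fin N → ℝ) (S : Finset (Fin N)) : ℝ :=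
  ∑ x : Fin τ → Fin N → Bool,
    (∏ s, ∏ n, if x s n = true then p n else 1 - p n) *
      (idleSlots τ (Equiv.refl (Fin N)) S
        (fun s n => if h : s < τ then x ⟨s, h⟩ n else false) : ℝ)

/-! ### The limit vector -/

/-- The quotient minimized over `S ⊋ H` in the definition of the critical sets. -/
noncomputable def criticalRatio (τ : ℕ) (p a b : Fin N → ℝ) (H S : Finset (Fin N)) : ℝ :=
  ((expectedIdle τ p H - expectedIdle τ p S) / τ - ∑ n ∈ S \ H, b n / a n) /
    ∑ n ∈ S \ H, 1 / a n

/-- `H 0 = ∅`, and as long as `H k` is not the set of all clients, `H (k + 1)` is a minimizer of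
`criticalRatio` over the sets `S ⊋ H k` which is maximal among the minimizers
(for definiteness the sequence stays constant once all clients are reached). -/
def IsCriticalSequence (τ : ℕ) (p a b : Fin N → ℝ) (H : ℕ → Finset (Fin N)) : Prop :=
  H 0 = ∅ ∧ ∀ k,
    (H k = Finset.univ → H (k + 1) = Finset.univ) ∧
    (H k ≠ Finset.univ →
      H k ⊂ H (k + 1) ∧
      (∀ S, H k ⊂ S →
        criticalRatio τ p a b (H k) (H (k + 1)) ≤ criticalRatio τ p a b (H k) S) ∧
      (∀ S, H (k + 1) ⊂ S →
        criticalRatio τ p a b (H k) (H (k + 1)) < criticalRatio τ p a b (H k) S))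

/-! ### The system over time -/

/-- The channel outcomes during period `k`, from the outcomes `X t n` in all slots `t`. -/
def periodChannel (τ : ℕ) (X : ℕ → Fin N → Bool) (k : ℕ) : ℕ → Fin N → Bool :=
  fun s n => X (k * τ + s) n

/-- `u_n(Kτ)`: the number of slots allocated to client `n` in periods `0, …, K - 1`, when the
priority order `r k` is used in period `k`. -/
def allocated (τ : ℕ) (r : ℕ → Equiv.Perm (Fin N)) (X : ℕ → Fin N → Bool) (K : ℕ) (n : Fin N) : ℕ :=
  ∑ k ∈ Finset.range K, workSlots τ (r k) Finset.univ (periodChannel τ X k) n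

/-- The vector of delivery ratios over the first `K` periods: the proportion of these periods in
which the packet of the client is delivered before the end of the period. -/
noncomputable def deliveryRatio (τ : ℕ) (r : ℕ → Equiv.Perm (Fin N)) (X : ℕ → Fin N → Bool)
    (K : ℕ) : Fin N → ℝ :=
  fun n => (((Finset.range K).filter
    (fun k => n ∉ pending (r k) Finset.univ (periodChannel τ X k) τ)).card : ℝ) / K

/-- The priority orders `r` are those of a generalized transmission time policy along a path: at
the beginning `t = kτ` of each period, clients with lower `a_n u_n(t) - b_n t` get higher priority
(ties may be broken in any way). -/
def IsGeneralizedTransmissionTime (τ : ℕ) (a b : Fin N → ℝ) (r : ℕ → Equiv.Perm (Fin N))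
    (X : ℕ → Fin N → Bool) : Prop :=
  ∀ (k : ℕ) (m n : Fin N),
    a m * (allocated τ r X k m : ℝ) - b m * ((k * τ : ℕ) : ℝ) <
      a n * (allocated τ r X k n : ℝ) - b n * ((k * τ : ℕ) : ℝ) →
    r k m < r k n

/-- Unreliable channels: `ℱ t` is the information available at the beginning of slot `t`, the
outcome of slot `t` is known at the beginning of slot `t + 1`, and, whatever happened before slot
`t`, a transmission for client `n` in slot `t` succeeds with probability `p n`. (Channel outcomes
that are independent over time satisfy this with their natural filtration.) -/
structure IsChannel {Ω : Type*} {mΩ : MeasurableSpace Ω} (μ : Measure Ω) (ℱ : Filtration ℕ mΩ)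
    (p : Fin N → ℝ) (X : ℕ → Fin N → Ω → Bool) : Prop where
  measurableSet_success : ∀ t n, MeasurableSet[ℱ (t + 1)] {ω | X t n ω = true}
  condProb_success : ∀ t n, μ⟦{ω | X t n ω = true} | ℱ t⟧ =ᵐ[μ] fun _ => p n

end DelayQoS

open DelayQoS

namespace DelayQoS

variable {N : ℕ}

/-! ### One slot -/

/-! Put `capacity S` = τ - I_S. Exchanging the order of service shows that the expected idle time of
a set of clients is independent of priorities. Hence under any priority order the expected work on
`S` in a period is at most `capacity S`, with equality when `S` has priority over the rest. So
`capacity` is submodular, every mean work vector lies in its base polytope (`IsFeasible`), and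
serving in increasing order of `y` minimizes the linear functional `y` over that polytope: the
greedy algorithm (`sum_mul_meanWork_sub_nonpos`).

The work rates `w n = τ (b n + θ_k) / a n` form the base that minimizes the strictly convex function
∑ (a_n w_n² / 2 - τ b_n w_n). `IsBalanced` is its first order condition. It holds since the gradient
is τ θ_k on each layer, θ_k is nondecreasing in k, and the critical sets are tight
(`IsCriticalSequence.isBalanced`). Its solution is unique, so the choice of critical sets does not
matter.

For convergence, let `f k` be the conditional mean work in period k given its priority order. The
policy is greedy for `y n = a n * u n - b n * (k τ)`. Together with the variational inequality this
gives ∑ a_n (u_n - k w_n)(f_n - w_n) ≤ 0, so a quadratic Lyapunov function grows only through noise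
(`tendsto_div_of_drift`). The differences between work and mean work, and between deliveries and `p
n` times work, are sums of bounded martingale differences and average to zero by a strong law
(`IsChannel.tendsto_slotNoise`). Hence u_n / k tends to w_n, and the delivery ratio to p_n w_n. -/

theorem Served.iff_eq {r : Equiv.Perm (Fin N)} {U : Finset (Fin N)} {m : Fin N}
    (h : Served r U m) (n : Fin N) : Served r U n ↔ n = m := by
  constructor
  · intro h'
    exact r.injective (le_antisymm (h'.2 m h.1) (h.2 n h'.1))
  · rintro rfl
    exact h

theorem exists_served (r : Equiv.Perm (Fin N)) {U : Finset (Fin N)} (hU : U.Nonempty) :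
    ∃ m, Served r U m :=
  U.exists_min_image r hU

theorem sum_ite_served {r : Equiv.Perm (Fin N)} {U : Finset (Fin N)} {m : Fin N}
    (h : Served r U m) (f : Fin N → ℝ) : (∑ n, if Served r U n then f n else 0) = f m := by
  simp_rw [h.iff_eq]
  simp

/-- The pending set after a slot with channel outcomes `o`. -/
def nextPending (r : Equiv.Perm (Fin N)) (U : Finset (Fin N)) (o : Fin N → Bool) :
    Finset (Fin N) :=
  U.filter (fun n => ¬ (Served r U n ∧ o n = true))

theorem pending_succ (r : Equiv.Perm (Fin N)) (S : Finset (Fin N)) (x : ℕ → Fin N → Bool) (s : ℕ) :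
    pending r S x (s + 1) = nextPending r (pending r S x s) (x s) := rfl

theorem Served.nextPending_eq {r : Equiv.Perm (Fin N)} {U : Finset (Fin N)} {m : Fin N}
    (h : Served r U m) (o : Fin N → Bool) :
    nextPending r U o = if o m = true then U.erase m else U := by
  ext n
  simp only [nextPending, Finset.mem_filter, h.iff_eq]
  split_ifs with ho
  · simp only [Finset.mem_erase]
    constructor
    · rintro ⟨hn, h'⟩
      exact ⟨fun e => h' ⟨e, e ▸ ho⟩, hn⟩
    · rintro ⟨h', hn⟩
      exact ⟨hn, fun e => h' e.1⟩
  · constructor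
    · exact fun h' => h'.1
    · exact fun hn => ⟨hn, fun e => ho (e.1 ▸ e.2)⟩

theorem nextPending_empty (r : Equiv.Perm (Fin N)) (o : Fin N → Bool) :
    nextPending r ∅ o = ∅ := by
  simp [nextPending]

theorem apply_nextPending (r : Equiv.Perm (Fin N)) (U : Finset (Fin N)) (o : Fin N → Bool)
    (φ : Finset (Fin N) → ℝ) :
    φ (nextPending r U o) = φ U +
      ∑ m, if Served r U m then (if o m = true then φ (U.erase m) - φ U else 0) else 0 := by
  rcases U.eq_empty_or_nonempty with rfl | hU
  · simp [nextPending_empty]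
  · obtain ⟨m, hm⟩ := exists_served r hU
    rw [sum_ite_served hm, hm.nextPending_eq]
    split_ifs <;> ring

/-! ### Expected rewards over a period -/

/-- The expected total of the rewards `c` of the pending sets in the next `s` slots. -/
noncomputable def expectedReward (p : Fin N → ℝ) (r : Equiv.Perm (Fin N))
    (c : Finset (Fin N) → ℝ) : ℕ → Finset (Fin N) → ℝ
  | 0, _ => 0
  | s + 1, U => c U + expectedReward p r c s U +
      ∑ m, if Served r U m then
        p m * (expectedReward p r c s (U.erase m) - expectedReward p r c s U) else 0

theorem Served.expectedReward_succ {r : Equiv.Perm (Fin N)} {U : Finset (Fin N)} {m : Fin N}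
    (h : Served r U m) (p : Fin N → ℝ) (c : Finset (Fin N) → ℝ) (s : ℕ) :
    expectedReward p r c (s + 1) U = c U + (p m * expectedReward p r c s (U.erase m) +
      (1 - p m) * expectedReward p r c s U) := by
  rw [expectedReward, sum_ite_served h]
  ring

theorem expectedReward_succ_empty (p : Fin N → ℝ) (r : Equiv.Perm (Fin N))
    (c : Finset (Fin N) → ℝ) (s : ℕ) :
    expectedReward p r c (s + 1) ∅ = c ∅ + expectedReward p r c s ∅ := by
  simp [expectedReward]

theorem expectedReward_sum (p : Fin N → ℝ) (r : Equiv.Perm (Fin N)) {ι : Type*} (A : Finset ι)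
    (c : ι → Finset (Fin N) → ℝ) (s : ℕ) (U : Finset (Fin N)) :
    expectedReward p r (fun V => ∑ i ∈ A, c i V) s U = ∑ i ∈ A, expectedReward p r (c i) s U := by
  induction s generalizing U with
  | zero => simp [expectedReward]
  | succ s ih =>
    rcases U.eq_empty_or_nonempty with rfl | hU
    · simp only [expectedReward_succ_empty, ih, Finset.sum_add_distrib]
    · obtain ⟨m, hm⟩ := exists_served r hU
      simp only [hm.expectedReward_succ, ih, Finset.sum_add_distrib, Finset.mul_sum]

theorem expectedReward_mem_Icc {p : Fin N → ℝ} (hp0 : ∀ n, 0 ≤ p n) (hp1 : ∀ n, p n ≤ 1)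
    (r : Equiv.Perm (Fin N)) {c : Finset (Fin N) → ℝ} (hc : ∀ U, c U ∈ Set.Icc (0 : ℝ) 1)
    (s : ℕ) (U : Finset (Fin N)) : expectedReward p r c s U ∈ Set.Icc (0 : ℝ) s := by
  induction s generalizing U with
  | zero => simp [expectedReward]
  | succ s ih =>
    have hcU := hc U
    have h1 := ih U
    rcases U.eq_empty_or_nonempty with rfl | hU
    · rw [expectedReward_succ_empty]
      push_cast
      exact ⟨add_nonneg hcU.1 h1.1, by linarith [hcU.2, h1.2]⟩
    · obtain ⟨m, hm⟩ := exists_served r hU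
      have h2 := ih (U.erase m)
      rw [hm.expectedReward_succ]
      push_cast
      have h0 := hp0 m
      have h0' : 0 ≤ 1 - p m := sub_nonneg.2 (hp1 m)
      constructor
      · exact add_nonneg hcU.1 (add_nonneg (mul_nonneg h0 h2.1) (mul_nonneg h0' h1.1))
      · have := mul_le_mul_of_nonneg_left h2.2 h0
        have := mul_le_mul_of_nonneg_left h1.2 h0'
        linarith [hcU.2]

/-- Expected number of idle slots among the next `s` slots, starting from the pending set `U`. -/
noncomputable def meanIdle (p : Fin N → ℝ) (r : Equiv.Perm (Fin N)) : ℕ → Finset (Fin N) → ℝ :=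
  expectedReward p r (fun U => if U = ∅ then 1 else 0)

/-- Expected number of slots spent on client `n` among the next `s` slots, starting from the
pending set `U`. -/
noncomputable def meanWork (p : Fin N → ℝ) (r : Equiv.Perm (Fin N)) (n : Fin N) :
    ℕ → Finset (Fin N) → ℝ :=
  expectedReward p r (fun U => if Served r U n then 1 else 0)

theorem meanIdle_empty (p : Fin N → ℝ) (r : Equiv.Perm (Fin N)) (s : ℕ) :
    meanIdle p r s ∅ = s := by
  induction s with
  | zero => simp [meanIdle, expectedReward]
  | succ s ih =>
    rw [meanIdle, expectedReward_succ_empty, ← meanIdle, ih]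
    push_cast
    simp [add_comm]

theorem Served.meanIdle_succ {r : Equiv.Perm (Fin N)} {U : Finset (Fin N)} {m : Fin N}
    (h : Served r U m) (p : Fin N → ℝ) (s : ℕ) :
    meanIdle p r (s + 1) U = p m * meanIdle p r s (U.erase m) + (1 - p m) * meanIdle p r s U := by
  rw [meanIdle, h.expectedReward_succ]
  simp [Finset.ne_empty_of_mem h.1]

/-- The recursion for the expected idle time may be started with any pending client. -/
theorem meanIdle_succ_of_mem (p : Fin N → ℝ) (r : Equiv.Perm (Fin N)) (s : ℕ)
    {U : Finset (Fin N)} {n : Fin N} (hn : n ∈ U) :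
    meanIdle p r (s + 1) U = p n * meanIdle p r s (U.erase n) + (1 - p n) * meanIdle p r s U := by
  induction s generalizing U with
  | zero =>
    obtain ⟨m, hm⟩ := exists_served r ⟨n, hn⟩
    rw [hm.meanIdle_succ]
    simp [meanIdle, expectedReward]
  | succ s ih =>
    obtain ⟨m, hm⟩ := exists_served r ⟨n, hn⟩
    rcases eq_or_ne n m with rfl | hne
    · exact hm.meanIdle_succ p _
    have hm' : Served r (U.erase n) m :=
      ⟨Finset.mem_erase.2 ⟨hne.symm, hm.1⟩, fun k hk => hm.2 k (Finset.mem_of_mem_erase hk)⟩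
    rw [hm.meanIdle_succ, hm'.meanIdle_succ, ih hn, ih (Finset.mem_erase.2 ⟨hne, hn⟩),
      Finset.erase_right_comm]
    have e := hm.meanIdle_succ p s
    rw [ih hn] at e
    -- Removing `m` then `n` agrees with removing `n` then `m`. What remains is `1 - p n` times the
    -- difference of the two expansions of `s + 1` slots from `U`, and these agree by `e`.
    linear_combination (p n - 1) * e

theorem meanIdle_eq (p : Fin N → ℝ) (r r' : Equiv.Perm (Fin N)) (s : ℕ) (U : Finset (Fin N)) :
    meanIdle p r s U = meanIdle p r' s U := by
  induction s generalizing U with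
  | zero => rfl
  | succ s ih =>
    rcases U.eq_empty_or_nonempty with rfl | hU
    · simp only [meanIdle_empty]
    · obtain ⟨m, hm⟩ := exists_served r hU
      rw [hm.meanIdle_succ, meanIdle_succ_of_mem p r' s hm.1, ih, ih]

theorem meanIdle_succ_le {p : Fin N → ℝ} (hp0 : ∀ n, 0 ≤ p n) (hp1 : ∀ n, p n ≤ 1)
    (r : Equiv.Perm (Fin N)) (s : ℕ) (U : Finset (Fin N)) :
    meanIdle p r (s + 1) U ≤ meanIdle p r s U + 1 := by
  induction s generalizing U with
  | zero =>
    refine (expectedReward_mem_Icc hp0 hp1 r (fun V => ?_) _ U).2.trans ?_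
    · split_ifs <;> simp
    · simp [meanIdle, expectedReward]
  | succ s ih =>
    rcases U.eq_empty_or_nonempty with rfl | hU
    · simp only [meanIdle_empty]
      push_cast
      rfl
    · obtain ⟨m, hm⟩ := exists_served r hU
      rw [hm.meanIdle_succ]
      have := hm.meanIdle_succ p s
      have := mul_le_mul_of_nonneg_left (ih (U.erase m)) (hp0 m)
      have := mul_le_mul_of_nonneg_left (ih U) (sub_nonneg.2 (hp1 m))
      linarith

theorem sum_meanWork_eq (p : Fin N → ℝ) (r : Equiv.Perm (Fin N)) (S : Finset (Fin N)) (s : ℕ)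
    (U : Finset (Fin N)) : ∑ n ∈ S, meanWork p r n s U =
      expectedReward p r (fun V => ∑ n ∈ S, if Served r V n then (1 : ℝ) else 0) s U :=
  (expectedReward_sum p r S _ s U).symm

theorem sum_meanWork_empty (p : Fin N → ℝ) (r : Equiv.Perm (Fin N)) (S : Finset (Fin N))
    (s : ℕ) : ∑ n ∈ S, meanWork p r n s ∅ = 0 := by
  rw [sum_meanWork_eq]
  induction s with
  | zero => rfl
  | succ s ih =>
    rw [expectedReward_succ_empty, ih]
    simp

theorem Served.sum_meanWork_succ {r : Equiv.Perm (Fin N)} {U : Finset (Fin N)} {m : Fin N}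
    (h : Served r U m) (p : Fin N → ℝ) (S : Finset (Fin N)) (s : ℕ) :
    ∑ n ∈ S, meanWork p r n (s + 1) U = (if m ∈ S then 1 else 0) +
      (p m * ∑ n ∈ S, meanWork p r n s (U.erase m) + (1 - p m) * ∑ n ∈ S, meanWork p r n s U) := by
  rw [sum_meanWork_eq, sum_meanWork_eq, sum_meanWork_eq, h.expectedReward_succ]
  simp_rw [h.iff_eq]
  simp

/-- The clients in `S` receive at most the slots in which they would be served without others. -/
theorem sum_meanWork_le {p : Fin N → ℝ} (hp0 : ∀ n, 0 ≤ p n) (hp1 : ∀ n, p n ≤ 1)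
    (r : Equiv.Perm (Fin N)) (S : Finset (Fin N)) (s : ℕ) (U : Finset (Fin N)) :
    ∑ n ∈ S, meanWork p r n s U ≤ s - meanIdle p r s (U ∩ S) := by
  induction s generalizing U with
  | zero => simp [meanIdle, meanWork, expectedReward]
  | succ s ih =>
    rcases U.eq_empty_or_nonempty with rfl | hU
    · simp [sum_meanWork_empty, meanIdle_empty]
    · obtain ⟨m, hm⟩ := exists_served r hU
      rw [hm.sum_meanWork_succ]
      have h1 := mul_le_mul_of_nonneg_left (ih (U.erase m)) (hp0 m)
      have h2 := mul_le_mul_of_nonneg_left (ih U) (sub_nonneg.2 (hp1 m))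
      push_cast
      rw [Finset.erase_inter] at h1
      split_ifs with hmS
      · rw [meanIdle_succ_of_mem p r s (Finset.mem_inter.2 ⟨hm.1, hmS⟩)]
        linarith
      -- A slot used outside `S` leaves `U ∩ S` unchanged, and one further slot can add at most one
      -- idle slot to the bound.
      · rw [Finset.erase_eq_of_notMem (s := U ∩ S) (by simp [hmS])] at h1
        linarith [meanIdle_succ_le hp0 hp1 r s (U ∩ S)]

/-- A slot goes to a client outside `S` only once nothing in `S` is pending, so no slot useful to
`S` is lost. The priority hypothesis is restricted to `U` so that it passes to `U.erase m`. -/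
theorem sum_meanWork_eq_of_initial (p : Fin N → ℝ) (r : Equiv.Perm (Fin N)) (S : Finset (Fin N))
    (s : ℕ) (U : Finset (Fin N)) (hS : ∀ m ∈ U ∩ S, ∀ n ∈ U, n ∉ S → r m < r n) :
    ∑ n ∈ S, meanWork p r n s U = s - meanIdle p r s (U ∩ S) := by
  induction s generalizing U with
  | zero => simp [meanIdle, meanWork, expectedReward]
  | succ s ih =>
    rcases U.eq_empty_or_nonempty with rfl | hU
    · simp [sum_meanWork_empty, meanIdle_empty]
    · obtain ⟨m, hm⟩ := exists_served r hU
      rw [hm.sum_meanWork_succ, ih U hS, ih (U.erase m), Finset.erase_inter]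
      · push_cast
        split_ifs with hmS
        · rw [meanIdle_succ_of_mem p r s (Finset.mem_inter.2 ⟨hm.1, hmS⟩)]
          ring
        · have : U ∩ S = ∅ := by
            by_contra hne
            obtain ⟨k, hk⟩ := Finset.nonempty_iff_ne_empty.2 hne
            exact absurd (hS k hk m hm.1 hmS) (not_lt.2 (hm.2 k (Finset.mem_inter.1 hk).1))
          simp [this, meanIdle_empty]
      · intro k hk n hn hnS
        rw [Finset.erase_inter] at hk
        exact hS k (Finset.mem_of_mem_erase hk) n (Finset.mem_of_mem_erase hn) hnS

/-! ### Identification of the expected idle time -/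

theorem idleSlots_succ (τ : ℕ) (r : Equiv.Perm (Fin N)) (S : Finset (Fin N))
    (x : ℕ → Fin N → Bool) : idleSlots (τ + 1) r S x =
      (if S = ∅ then 1 else 0) + idleSlots τ r (nextPending r S (x 0)) (fun s => x (s + 1)) := by
  have key : ∀ s, pending r S x (s + 1) =
      pending r (nextPending r S (x 0)) (fun s => x (s + 1)) s := by
    intro s
    induction s with
    | zero => rfl
    | succ s ih => rw [pending_succ, ih, ← pending_succ]
  simp only [idleSlots, Finset.card_filter, Finset.sum_range_succ', key]
  rw [add_comm]
  rfl

theorem idleSlots_congr (τ : ℕ) (r : Equiv.Perm (Fin N)) (S : Finset (Fin N))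
    {x y : ℕ → Fin N → Bool} (h : ∀ s < τ, x s = y s) : idleSlots τ r S x = idleSlots τ r S y := by
  have key : ∀ s ≤ τ, pending r S x s = pending r S y s := by
    intro s hs
    induction s with
    | zero => rfl
    | succ s ih => rw [pending_succ, pending_succ, ih (by omega), h s (by omega)]
  unfold idleSlots
  congr 1
  refine Finset.filter_congr fun s hs => ?_
  rw [key s (Finset.mem_range.1 hs).le]

theorem sum_prod_bernoulli (p : Fin N → ℝ) :
    ∑ o : Fin N → Bool, (∏ n, if o n = true then p n else 1 - p n) = 1 := by
  rw [← Fintype.piFinset_univ, ← Finset.prod_univ_sum (fun _ => Finset.univ)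
    (fun n (b : Bool) => if b = true then p n else 1 - p n)]
  simp

theorem sum_prod_bernoulli_mul (p : Fin N → ℝ) (m : Fin N) (φ : Bool → ℝ) :
    ∑ o : Fin N → Bool, (∏ n, if o n = true then p n else 1 - p n) * φ (o m) =
      p m * φ true + (1 - p m) * φ false := by
  have h : ∀ o : Fin N → Bool, (∏ n, if o n = true then p n else 1 - p n) * φ (o m) =
      ∏ n, (if o n = true then p n else 1 - p n) * (if n = m then φ (o n) else 1) := by
    intro o
    rw [Finset.prod_mul_distrib, Finset.prod_ite_eq' Finset.univ m (fun n => φ (o n))]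
    simp
  simp_rw [h]
  rw [← Fintype.piFinset_univ, ← Finset.prod_univ_sum (fun _ => Finset.univ)
    (fun n (b : Bool) => (if b = true then p n else 1 - p n) * (if n = m then φ b else 1))]
  rw [Finset.prod_eq_single m]
  · simp
  · intro n _ hn
    simp [hn]
  · simp

/-- The product weight factors over slots. Splitting off the first slot reproduces the recursion of
`meanIdle`, since only the outcome of the served client matters there. -/
theorem sum_weight_idleSlots (τ : ℕ) (p : Fin N → ℝ) (r : Equiv.Perm (Fin N))
    (S : Finset (Fin N)) :
    ∑ x : Fin τ → Fin N → Bool, (∏ s, ∏ n, if x s n = true then p n else 1 - p n) *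
      (idleSlots τ r S (fun s n => if h : s < τ then x ⟨s, h⟩ n else false) : ℝ) =
      meanIdle p r τ S := by
  induction τ generalizing S with
  | zero => simp [idleSlots, meanIdle, expectedReward]
  | succ τ ih =>
    have hw : ∑ x : Fin τ → Fin N → Bool,
        (∏ s, ∏ n, if x s n = true then p n else 1 - p n) = 1 := by
      rw [← Fintype.piFinset_univ, ← Finset.prod_univ_sum (fun _ => Finset.univ)
        (fun _ (o : Fin N → Bool) => ∏ n, if o n = true then p n else 1 - p n)]
      simp [sum_prod_bernoulli]
    have hx : ∀ (o : Fin N → Bool) (x : Fin τ → Fin N → Bool),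
        idleSlots (τ + 1) r S (fun s n => if h : s < τ + 1 then
          (Fin.cons o x : Fin (τ + 1) → Fin N → Bool) ⟨s, h⟩ n else false) =
        (if S = ∅ then 1 else 0) + idleSlots τ r (nextPending r S o)
          (fun s n => if h : s < τ then x ⟨s, h⟩ n else false) := by
      intro o x
      rw [idleSlots_succ]
      congr 1
      refine idleSlots_congr _ _ _ fun s hs => ?_
      ext n
      simp only [Nat.add_lt_add_iff_right, hs, dite_true]
      have : (⟨s + 1, by omega⟩ : Fin (τ + 1)) = Fin.succ ⟨s, hs⟩ := rfl
      rw [this, Fin.cons_succ]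
    have hE : ∑ x : Fin (τ + 1) → Fin N → Bool,
        (∏ s, ∏ n, if x s n = true then p n else 1 - p n) *
        (idleSlots (τ + 1) r S (fun s n => if h : s < τ + 1 then x ⟨s, h⟩ n else false) : ℝ) =
        ∑ o : Fin N → Bool, (∏ n, if o n = true then p n else 1 - p n) *
          ((if S = ∅ then 1 else 0) + meanIdle p r τ (nextPending r S o)) := by
      rw [← (Fin.consEquiv (fun _ : Fin (τ + 1) => Fin N → Bool)).sum_comp,
        Fintype.sum_prod_type]
      refine Finset.sum_congr rfl fun o _ => ?_
      have e : ∀ A c : ℝ, A * c = ∑ x : Fin τ → Fin N → Bool,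
          A * (∏ s, ∏ n, if x s n = true then p n else 1 - p n) * c := by
        intro A c
        rw [← Finset.sum_mul, ← Finset.mul_sum, hw, mul_one]
      rw [mul_add, ← ih, e, Finset.mul_sum, ← Finset.sum_add_distrib]
      refine Finset.sum_congr rfl fun x _ => ?_
      simp only [Fin.consEquiv_apply, Fin.prod_univ_succ, Fin.cons_zero, Fin.cons_succ, hx]
      push_cast
      ring
    rw [hE]
    rcases S.eq_empty_or_nonempty with rfl | hS
    · simp only [nextPending_empty, ← Finset.sum_mul, sum_prod_bernoulli, meanIdle_empty]
      push_cast
      simp [add_comm]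
    · obtain ⟨m, hm⟩ := exists_served r hS
      simp only [hS.ne_empty, if_false, zero_add, hm.nextPending_eq]
      rw [sum_prod_bernoulli_mul p m
        (fun b => meanIdle p r τ (if b = true then S.erase m else S)), hm.meanIdle_succ]
      simp

theorem expectedIdle_eq_meanIdle (τ : ℕ) (p : Fin N → ℝ) (r : Equiv.Perm (Fin N))
    (S : Finset (Fin N)) : expectedIdle τ p S = meanIdle p r τ S := by
  rw [meanIdle_eq p r (Equiv.refl _), ← sum_weight_idleSlots]
  rfl


/-! ### The capacity region -/

/-- The largest expected number of slots per period that can be spent on the clients in `S`. -/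
noncomputable def capacity (τ : ℕ) (p : Fin N → ℝ) (S : Finset (Fin N)) : ℝ :=
  τ - expectedIdle τ p S

theorem capacity_empty (τ : ℕ) (p : Fin N → ℝ) : capacity τ p ∅ = 0 := by
  rw [capacity, expectedIdle_eq_meanIdle τ p (Equiv.refl _), meanIdle_empty, sub_self]

theorem sum_meanWork_le_capacity {p : Fin N → ℝ} (hp0 : ∀ n, 0 ≤ p n) (hp1 : ∀ n, p n ≤ 1)
    (τ : ℕ) (r : Equiv.Perm (Fin N)) (S : Finset (Fin N)) :
    ∑ n ∈ S, meanWork p r n τ Finset.univ ≤ capacity τ p S := by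
  rw [capacity, expectedIdle_eq_meanIdle τ p r]
  simpa using sum_meanWork_le hp0 hp1 r S τ Finset.univ

theorem sum_meanWork_eq_capacity (p : Fin N → ℝ) (τ : ℕ) (r : Equiv.Perm (Fin N))
    (S : Finset (Fin N)) (hS : ∀ m ∈ S, ∀ n ∉ S, r m < r n) :
    ∑ n ∈ S, meanWork p r n τ Finset.univ = capacity τ p S := by
  rw [capacity, expectedIdle_eq_meanIdle τ p r]
  have := sum_meanWork_eq_of_initial p r S τ Finset.univ
    (fun m hm n _ hn => hS m (Finset.mem_inter.1 hm).2 n hn)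
  simpa using this

theorem exists_perm_of_key (key : Fin N → ℕ) :
    ∃ r : Equiv.Perm (Fin N), ∀ m n, key m < key n → r m < r n := by
  refine ⟨(Tuple.sort key).symm, fun m n h => ?_⟩
  by_contra hle
  have := Tuple.monotone_sort key (not_lt.1 hle)
  simp only [Function.comp_apply, Equiv.apply_symm_apply] at this
  omega

/-- Give `A ∩ B` top priority, then the rest of `A ∪ B`. This single order attains the capacity of
both the intersection and the union, while `A` and `B` receive at most theirs. -/
theorem capacity_submodular {p : Fin N → ℝ} (hp0 : ∀ n, 0 ≤ p n) (hp1 : ∀ n, p n ≤ 1)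
    (τ : ℕ) (A B : Finset (Fin N)) :
    capacity τ p (A ∪ B) + capacity τ p (A ∩ B) ≤ capacity τ p A + capacity τ p B := by
  obtain ⟨r, hr⟩ := exists_perm_of_key
    (fun n : Fin N => if n ∈ A ∩ B then 0 else if n ∈ A ∪ B then 1 else 2)
  rw [← sum_meanWork_eq_capacity p τ r (A ∪ B), ← sum_meanWork_eq_capacity p τ r (A ∩ B),
    Finset.sum_union_inter]
  · exact add_le_add (sum_meanWork_le_capacity hp0 hp1 τ r A)
      (sum_meanWork_le_capacity hp0 hp1 τ r B)
  · intro m hm n hn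
    apply hr
    simp only [hm, hn, if_true, if_false]
    split_ifs <;> omega
  · intro m hm n hn
    apply hr
    have : n ∉ A ∩ B := fun h => hn (Finset.mem_union_left _ (Finset.mem_inter.1 h).1)
    simp only [hm, hn, this, if_true, if_false]
    split_ifs <;> omega

/-- The base polytope of the capacity function. -/
def IsFeasible (τ : ℕ) (p : Fin N → ℝ) (w : Fin N → ℝ) : Prop :=
  (∀ S, ∑ n ∈ S, w n ≤ capacity τ p S) ∧ ∑ n, w n = capacity τ p Finset.univ

theorem isFeasible_meanWork {p : Fin N → ℝ} (hp0 : ∀ n, 0 ≤ p n) (hp1 : ∀ n, p n ≤ 1)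
    (τ : ℕ) (r : Equiv.Perm (Fin N)) :
    IsFeasible τ p (fun n => meanWork p r n τ Finset.univ) :=
  ⟨sum_meanWork_le_capacity hp0 hp1 τ r,
    sum_meanWork_eq_capacity p τ r Finset.univ (fun _ _ n hn => absurd (Finset.mem_univ n) hn)⟩

/-- Variational characterization of the limiting numbers of slots per period. -/
def IsBalanced (τ : ℕ) (p a b : Fin N → ℝ) (w : Fin N → ℝ) : Prop :=
  IsFeasible τ p w ∧ ∀ x, IsFeasible τ p x → 0 ≤ ∑ n, (a n * w n - τ * b n) * (x n - w n)

/-- Testing each solution against the other and adding gives -∑ a_n (w_n - w'_n)² ≥ 0. -/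
theorem IsBalanced.unique {τ : ℕ} {p a b : Fin N → ℝ} (ha : ∀ n, 0 < a n) {w w' : Fin N → ℝ}
    (h : IsBalanced τ p a b w) (h' : IsBalanced τ p a b w') : w = w' := by
  have h1 := add_nonneg (h.2 w' h'.1) (h'.2 w h.1)
  rw [← Finset.sum_add_distrib] at h1
  have h2 : ∑ n, a n * (w n - w' n) ^ 2 ≤ 0 := by
    rw [← neg_nonneg, ← Finset.sum_neg_distrib]
    refine h1.trans_eq (Finset.sum_congr rfl fun n _ => ?_)
    ring
  have h3 : ∀ n ∈ Finset.univ, 0 ≤ a n * (w n - w' n) ^ 2 :=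
    fun n _ => mul_nonneg (ha n).le (sq_nonneg _)
  have h4 := (Finset.sum_eq_zero_iff_of_nonneg h3).1 (le_antisymm h2 (Finset.sum_nonneg h3))
  ext n
  have := h4 n (Finset.mem_univ n)
  rw [mul_eq_zero, or_iff_right (ha n).ne', sq_eq_zero_iff, sub_eq_zero] at this
  exact this

/-! ### Summation over sublevel sets -/

/-- Abel summation, by removing an element `e` of largest `y` and lowering `M` to `y e`. Requiring
the hypothesis only for `c < M` lets it pass to the smaller set: such levels below `y e` do not see
`e`. -/
theorem sum_sub_mul_nonneg {ι : Type*} [DecidableEq ι] (y d : ι → ℝ) (s : Finset ι) (M : ℝ)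
    (hM : ∀ n ∈ s, y n ≤ M) (h : ∀ c < M, 0 ≤ ∑ n ∈ s with y n ≤ c, d n) :
    0 ≤ ∑ n ∈ s, (M - y n) * d n := by
  induction s using Finset.induction_on_max_value y generalizing M with
  | empty => simp
  | insert e s he hmax ih =>
    have h1 : 0 ≤ ∑ n ∈ s, (y e - y n) * d n := by
      refine ih (y e) hmax fun c hc => ?_
      have := h c (hc.trans_le (hM e (Finset.mem_insert_self _ _)))
      rwa [Finset.filter_insert, if_neg (not_le.2 hc)] at this
    have h2 : 0 ≤ (M - y e) * ∑ n ∈ insert e s, d n := by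
      rcases (hM e (Finset.mem_insert_self _ _)).eq_or_lt with heq | hlt
      · simp [heq]
      · have := h (y e) hlt
        rw [Finset.filter_true_of_mem] at this
        · exact mul_nonneg (sub_pos.2 hlt).le this
        · intro n hn
          rcases Finset.mem_insert.1 hn with rfl | hn
          · exact le_rfl
          · exact hmax n hn
    have h3 : ∑ n ∈ insert e s, (M - y n) * d n =
        (M - y e) * ∑ n ∈ insert e s, d n + ∑ n ∈ s, (y e - y n) * d n := by
      rw [Finset.sum_insert he, Finset.sum_insert he, mul_add, Finset.mul_sum, add_assoc,
        ← Finset.sum_add_distrib]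
      congr 1
      exact Finset.sum_congr rfl fun n _ => by ring
    rw [h3]
    exact add_nonneg h2 h1

theorem sum_mul_nonpos_of_sublevel {ι : Type*} [Fintype ι] [DecidableEq ι] (y d : ι → ℝ)
    (h : ∀ c, 0 ≤ ∑ n with y n ≤ c, d n) (h0 : ∑ n, d n = 0) : ∑ n, y n * d n ≤ 0 := by
  obtain ⟨M, hM⟩ := (Set.finite_range y).bddAbove
  have := sum_sub_mul_nonneg y d Finset.univ M (fun n _ => hM ⟨n, rfl⟩) (fun c _ => h c)
  simp only [sub_mul, Finset.sum_sub_distrib, ← Finset.mul_sum, h0, mul_zero] at this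
  linarith

/-- Serving clients in increasing order of `y` minimizes the total of `y` over the slots. -/
theorem sum_mul_meanWork_sub_nonpos {τ : ℕ} {p : Fin N → ℝ} {x : Fin N → ℝ}
    (hp0 : ∀ n, 0 ≤ p n) (hp1 : ∀ n, p n ≤ 1)
    (hx : IsFeasible τ p x) (y : Fin N → ℝ) (r : Equiv.Perm (Fin N))
    (hr : ∀ m n, y m < y n → r m < r n) :
    ∑ n, y n * (meanWork p r n τ Finset.univ - x n) ≤ 0 := by
  apply sum_mul_nonpos_of_sublevel y
  · intro c
    -- Sublevel sets of `y` are initial segments of the order `r`, hence tight for the mean work.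
    rw [Finset.sum_sub_distrib, sub_nonneg, sum_meanWork_eq_capacity]
    · exact hx.1 _
    · intro m hm n hn
      simp only [Finset.mem_filter, Finset.mem_univ, true_and, not_le] at hm hn
      exact hr m n (hm.trans_lt hn)
  · rw [Finset.sum_sub_distrib, hx.2, (isFeasible_meanWork hp0 hp1 τ r).2, sub_self]

/-! ### Critical sequences -/

section Critical

variable {τ : ℕ} {p a b : Fin N → ℝ} {H : ℕ → Finset (Fin N)}

/-- Clearing denominators turns the ratio into a capacity constraint: the rates with common level
`θ` on `S \ A` fit into the capacity gained from `A` to `S`. -/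
theorem le_criticalRatio_iff (hτ : 0 < τ) (ha : ∀ n, 0 < a n) {A S : Finset (Fin N)}
    (hAS : A ⊂ S) (θ : ℝ) : θ ≤ criticalRatio τ p a b A S ↔
      ∑ n ∈ S \ A, τ * ((b n + θ) / a n) ≤ capacity τ p S - capacity τ p A := by
  have hD : 0 < ∑ n ∈ S \ A, 1 / a n :=
    Finset.sum_pos (fun n _ => one_div_pos.2 (ha n)) (Finset.sdiff_nonempty.2 hAS.2)
  have hτ' : (0 : ℝ) < τ := by exact_mod_cast hτ
  have e : ∑ n ∈ S \ A, τ * ((b n + θ) / a n) =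
      (∑ n ∈ S \ A, b n / a n + θ * ∑ n ∈ S \ A, 1 / a n) * τ := by
    rw [Finset.mul_sum, ← Finset.sum_add_distrib, Finset.sum_mul]
    exact Finset.sum_congr rfl fun n _ => by ring
  rw [criticalRatio, le_div_iff₀ hD, le_sub_iff_add_le', le_div_iff₀ hτ', e, capacity, capacity]
  ring_nf

theorem sum_criticalRatio (hτ : 0 < τ) (ha : ∀ n, 0 < a n) {A S : Finset (Fin N)}
    (hAS : A ⊂ S) : ∑ n ∈ S \ A, τ * ((b n + criticalRatio τ p a b A S) / a n) =
      capacity τ p S - capacity τ p A := by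
  have hD : 0 < ∑ n ∈ S \ A, 1 / a n :=
    Finset.sum_pos (fun n _ => one_div_pos.2 (ha n)) (Finset.sdiff_nonempty.2 hAS.2)
  have hτ' : (0 : ℝ) < τ := by exact_mod_cast hτ
  have e : ∑ n ∈ S \ A, τ * ((b n + criticalRatio τ p a b A S) / a n) =
      (∑ n ∈ S \ A, b n / a n + criticalRatio τ p a b A S * ∑ n ∈ S \ A, 1 / a n) * τ := by
    rw [Finset.mul_sum, ← Finset.sum_add_distrib, Finset.sum_mul]
    exact Finset.sum_congr rfl fun n _ => by ring
  rw [e, criticalRatio, div_mul_cancel₀ _ hD.ne', add_sub_cancel, div_mul_cancel₀ _ hτ'.ne',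
    capacity, capacity]
  ring

theorem exists_isCriticalSequence (τ : ℕ) (p a b : Fin N → ℝ) :
    ∃ H, IsCriticalSequence τ p a b H := by
  have step : ∀ A : Finset (Fin N), ∃ S, (A = Finset.univ → S = Finset.univ) ∧
      (A ≠ Finset.univ → A ⊂ S ∧
        (∀ T, A ⊂ T → criticalRatio τ p a b A S ≤ criticalRatio τ p a b A T) ∧
        (∀ T, S ⊂ T → criticalRatio τ p a b A S < criticalRatio τ p a b A T)) := by
    intro A
    rcases eq_or_ne A Finset.univ with hA | hA
    · exact ⟨Finset.univ, fun _ => rfl, fun h => absurd hA h⟩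
    have hne : (Finset.univ.filter (fun S => A ⊂ S)).Nonempty :=
      ⟨Finset.univ, by simpa using (Finset.ssubset_univ_iff.2 hA)⟩
    obtain ⟨S₀, hS₀, hmin⟩ := Finset.exists_min_image _ (criticalRatio τ p a b A) hne
    simp only [Finset.mem_filter, Finset.mem_univ, true_and] at hS₀ hmin
    -- A minimizer of largest cardinality is maximal for inclusion.
    obtain ⟨S, hS, hmax⟩ := Finset.exists_max_image
      (Finset.univ.filter (fun S => A ⊂ S ∧
        criticalRatio τ p a b A S = criticalRatio τ p a b A S₀))
      Finset.card ⟨S₀, by simpa using hS₀⟩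
    simp only [Finset.mem_filter, Finset.mem_univ, true_and] at hS hmax
    refine ⟨S, fun h => absurd h hA, fun _ => ⟨hS.1, fun T hT => hS.2.trans_le (hmin T hT),
      fun T hT => ?_⟩⟩
    have hAT := hS.1.trans hT
    refine (hS.2.trans_le (hmin T hAT)).lt_of_ne fun heq => ?_
    exact absurd (hmax T ⟨hAT, heq.symm.trans hS.2⟩) (not_le.2 (Finset.card_lt_card hT))
  choose next hnext using step
  exact ⟨fun k => Nat.rec ∅ (fun _ A => next A) k, rfl, fun k => hnext _⟩

theorem IsCriticalSequence.monotone (h : IsCriticalSequence τ p a b H) : Monotone H := by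
  refine monotone_nat_of_le_succ fun k => ?_
  rcases eq_or_ne (H k) Finset.univ with hk | hk
  · rw [(h.2 k).1 hk]
    exact Finset.subset_univ _
  · exact ((h.2 k).2 hk).1.1

theorem IsCriticalSequence.exists_eq_univ (h : IsCriticalSequence τ p a b H) :
    ∃ k, H k = Finset.univ := by
  by_contra! hne
  have hcard : ∀ k, k ≤ (H k).card := by
    intro k
    induction k with
    | zero => exact Nat.zero_le _
    | succ k ih => exact ih.trans_lt (Finset.card_lt_card ((h.2 k).2 (hne k)).1)
  have h1 := hcard (N + 1)
  have h2 := Finset.card_le_univ (H (N + 1))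
  rw [Fintype.card_fin] at h2
  omega

theorem IsCriticalSequence.exists_mem_sdiff (h : IsCriticalSequence τ p a b H) (n : Fin N) :
    ∃ k, n ∈ H (k + 1) \ H k := by
  by_contra! hn
  have : ∀ k, n ∉ H k := by
    intro k
    induction k with
    | zero => simp [h.1]
    | succ k ih => exact fun hk => hn k (Finset.mem_sdiff.2 ⟨hk, ih⟩)
  obtain ⟨k, hk⟩ := h.exists_eq_univ
  exact this k (hk ▸ Finset.mem_univ n)

theorem IsCriticalSequence.lt_iff_mem (h : IsCriticalSequence τ p a b H) {n : Fin N} {k : ℕ}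
    (hn : n ∈ H (k + 1) \ H k) (j : ℕ) : k < j ↔ n ∈ H j := by
  rw [Finset.mem_sdiff] at hn
  refine ⟨fun hkj => h.monotone hkj hn.1, fun hj => ?_⟩
  by_contra hle
  exact hn.2 (h.monotone (not_lt.1 hle) hj)

theorem IsCriticalSequence.index_unique (h : IsCriticalSequence τ p a b H) {n : Fin N} {j k : ℕ}
    (hj : n ∈ H (j + 1) \ H j) (hk : n ∈ H (k + 1) \ H k) : j = k := by
  have h1 := (h.lt_iff_mem hj (k + 1)).2 (Finset.mem_sdiff.1 hk).1
  have h2 := (h.lt_iff_mem hk (j + 1)).2 (Finset.mem_sdiff.1 hj).1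
  omega

theorem IsCriticalSequence.ne_univ_of_mem_sdiff {n : Fin N} {k : ℕ}
    (hn : n ∈ H (k + 1) \ H k) : H k ≠ Finset.univ :=
  fun e => (Finset.mem_sdiff.1 hn).2 (e ▸ Finset.mem_univ n)

/-- `H (k + 2)` competes at stage `k`, so level θ_k fits on `H (k + 2) \ H k`. It is tight on `H (k
+ 1) \ H k`, so it fits on the remaining layer. -/
theorem IsCriticalSequence.criticalRatio_le_succ (h : IsCriticalSequence τ p a b H) (hτ : 0 < τ)
    (ha : ∀ n, 0 < a n) {k : ℕ} (hk : H (k + 1) ≠ Finset.univ) :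
    criticalRatio τ p a b (H k) (H (k + 1)) ≤
      criticalRatio τ p a b (H (k + 1)) (H (k + 2)) := by
  have hk0 : H k ≠ Finset.univ := fun e => hk ((h.2 k).1 e)
  obtain ⟨h1, hmin, -⟩ := (h.2 k).2 hk0
  obtain ⟨h2, -, -⟩ := (h.2 (k + 1)).2 hk
  have h3 := (le_criticalRatio_iff hτ ha (h1.trans h2) _).1 (hmin _ (h1.trans h2))
  rw [le_criticalRatio_iff hτ ha h2]
  have h4 : (H (k + 2) \ H k) = (H (k + 2) \ H (k + 1)) ∪ (H (k + 1) \ H k) :=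
    (Finset.sdiff_union_sdiff_cancel h2.1 h1.1).symm
  change ∑ n ∈ H (k + 2) \ H k, _ ≤ capacity τ p (H (k + 2)) - _ at h3
  rw [h4, Finset.sum_union (Finset.disjoint_left.2 fun n hn hn' =>
    (Finset.mem_sdiff.1 hn).2 (Finset.mem_sdiff.1 hn').1), sum_criticalRatio hτ ha h1] at h3
  linarith

/-- The restriction on `H k` is needed: once all clients are reached the ratio takes the default
value 0 / 0 = 0. -/
theorem IsCriticalSequence.criticalRatio_mono (h : IsCriticalSequence τ p a b H) (hτ : 0 < τ)
    (ha : ∀ n, 0 < a n) {j k : ℕ} (hjk : j ≤ k) (hk : H k ≠ Finset.univ) :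
    criticalRatio τ p a b (H j) (H (j + 1)) ≤ criticalRatio τ p a b (H k) (H (k + 1)) := by
  induction k, hjk using Nat.le_induction with
  | base => exact le_rfl
  | succ k hjk ih =>
    exact (ih fun e => hk ((h.2 k).1 e)).trans (h.criticalRatio_le_succ hτ ha hk)

/-- Rates given by the critical ratios are feasible, and tight on the critical sets. -/
theorem IsCriticalSequence.sum_le_capacity (h : IsCriticalSequence τ p a b H) (hτ : 0 < τ)
    (ha : ∀ n, 0 < a n) (hp0 : ∀ n, 0 ≤ p n) (hp1 : ∀ n, p n ≤ 1) {w : Fin N → ℝ}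
    (hw : ∀ k, ∀ n ∈ H (k + 1) \ H k,
      w n = τ * ((b n + criticalRatio τ p a b (H k) (H (k + 1))) / a n))
    (S : Finset (Fin N)) (k : ℕ) : ∑ n ∈ S ∩ H k, w n ≤ capacity τ p (S ∩ H k) := by
  induction k with
  | zero => simp [h.1, capacity_empty]
  | succ k ih =>
    have hsplit : S ∩ H (k + 1) = (S ∩ H k) ∪ (S ∩ (H (k + 1) \ H k)) := by
      rw [← Finset.inter_union_distrib_left, Finset.union_sdiff_of_subset (h.monotone k.le_succ)]
    have hdisj : Disjoint (S ∩ H k) (S ∩ (H (k + 1) \ H k)) :=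
      Finset.disjoint_left.2 fun n hn hn' =>
        (Finset.mem_sdiff.1 (Finset.mem_inter.1 hn').2).2 (Finset.mem_inter.1 hn).2
    rcases (S ∩ (H (k + 1) \ H k)).eq_empty_or_nonempty with he | ⟨n₀, hn₀⟩
    · rwa [hsplit, he, Finset.union_empty]
    have hk : H k ≠ Finset.univ := ne_univ_of_mem_sdiff (Finset.mem_inter.1 hn₀).2
    -- This union competes at stage `k`, which bounds the new part of the sum by `capacity (H k ∪ S
    -- ∩ H (k + 1)) - capacity (H k)`. Submodularity bounds that by `capacity (S ∩ H (k + 1)) -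
    -- capacity (S ∩ H k)`.
    have hss : H k ⊂ H k ∪ S ∩ H (k + 1) := by
      refine ⟨Finset.subset_union_left, fun hsub => ?_⟩
      simp only [Finset.mem_inter, Finset.mem_sdiff] at hn₀
      exact hn₀.2.2 (hsub (Finset.mem_union_right _ (Finset.mem_inter.2 ⟨hn₀.1, hn₀.2.1⟩)))
    have h1 := (le_criticalRatio_iff hτ ha hss _).1 (((h.2 k).2 hk).2.1 _ hss)
    have h2 : (H k ∪ S ∩ H (k + 1)) \ H k = S ∩ (H (k + 1) \ H k) := by
      ext n
      simp only [Finset.mem_sdiff, Finset.mem_union, Finset.mem_inter]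
      tauto
    have h3 : H k ∩ (S ∩ H (k + 1)) = S ∩ H k := by
      ext n
      simp only [Finset.mem_inter]
      have : n ∈ H k → n ∈ H (k + 1) := fun hn => h.monotone k.le_succ hn
      tauto
    have h4 := capacity_submodular hp0 hp1 τ (H k) (S ∩ H (k + 1))
    rw [h3] at h4
    rw [h2] at h1
    have h5 : ∑ n ∈ S ∩ H (k + 1), w n = ∑ n ∈ S ∩ H k, w n + ∑ n ∈ S ∩ (H (k + 1) \ H k),
        τ * ((b n + criticalRatio τ p a b (H k) (H (k + 1))) / a n) := by
      rw [hsplit, Finset.sum_union hdisj]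
      congr 1
      exact Finset.sum_congr rfl fun n hn => hw k n (Finset.mem_inter.1 hn).2
    linarith

theorem IsCriticalSequence.sum_eq_capacity (h : IsCriticalSequence τ p a b H) (hτ : 0 < τ)
    (ha : ∀ n, 0 < a n) {w : Fin N → ℝ}
    (hw : ∀ k, ∀ n ∈ H (k + 1) \ H k,
      w n = τ * ((b n + criticalRatio τ p a b (H k) (H (k + 1))) / a n)) (k : ℕ) :
    ∑ n ∈ H k, w n = capacity τ p (H k) := by
  induction k with
  | zero => simp [h.1, capacity_empty]
  | succ k ih =>
    rcases eq_or_ne (H k) Finset.univ with hk | hk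
    · rwa [(h.2 k).1 hk, ← hk]
    · rw [← Finset.sum_sdiff (h.monotone k.le_succ), ih, Finset.sum_congr rfl (hw k),
        sum_criticalRatio hτ ha ((h.2 k).2 hk).1]
      ring

/-- The gradient `a n * w n - τ * b n` equals τ times the critical ratio of the layer of `n`. The
sublevel sets of these ratios are critical sets, where `w` uses all the capacity and `x` at most
that. -/
theorem IsCriticalSequence.isBalanced (h : IsCriticalSequence τ p a b H) (hτ : 0 < τ)
    (ha : ∀ n, 0 < a n) (hp0 : ∀ n, 0 ≤ p n) (hp1 : ∀ n, p n ≤ 1) {w : Fin N → ℝ}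
    (hw : ∀ k, ∀ n ∈ H (k + 1) \ H k,
      w n = τ * ((b n + criticalRatio τ p a b (H k) (H (k + 1))) / a n)) :
    IsBalanced τ p a b w := by
  obtain ⟨K, hK⟩ := h.exists_eq_univ
  have hfeas : IsFeasible τ p w := by
    refine ⟨fun S => ?_, ?_⟩
    · have := h.sum_le_capacity hτ ha hp0 hp1 hw S K
      rwa [hK, Finset.inter_univ] at this
    · have := h.sum_eq_capacity hτ ha hw K
      rwa [hK] at this
  refine ⟨hfeas, fun x hx => ?_⟩
  choose κ hκ using h.exists_mem_sdiff
  have hτ' : (0 : ℝ) < τ := by exact_mod_cast hτ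
  have key : ∑ n, criticalRatio τ p a b (H (κ n)) (H (κ n + 1)) * (w n - x n) ≤ 0 := by
    apply sum_mul_nonpos_of_sublevel
    · intro c
      -- The first such `j` ends the layers of ratio at most `c`. The alternative `H j = univ`
      -- covers levels above all ratios.
      have hex : ∃ j, H j = Finset.univ ∨ c < criticalRatio τ p a b (H j) (H (j + 1)) :=
        ⟨K, Or.inl hK⟩
      classical
      have hset : (Finset.univ.filter fun n =>
          criticalRatio τ p a b (H (κ n)) (H (κ n + 1)) ≤ c) = H (Nat.find hex) := by
        ext n
        rw [Finset.mem_filter, ← h.lt_iff_mem (hκ n)]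
        simp only [Finset.mem_univ, true_and]
        constructor
        · intro hc
          by_contra hle
          have hne : H (κ n) ≠ Finset.univ := ne_univ_of_mem_sdiff (hκ n)
          rcases Nat.find_spec hex with hu | hlt
          · exact hne (Finset.univ_subset_iff.1 (hu ▸ h.monotone (not_lt.1 hle)))
          · exact absurd (hlt.trans_le (h.criticalRatio_mono hτ ha (not_lt.1 hle) hne))
              (not_lt.2 hc)
        · intro hlt
          exact not_lt.1 fun hc => Nat.find_min hex hlt (Or.inr hc)
      rw [hset, Finset.sum_sub_distrib, h.sum_eq_capacity hτ ha hw, sub_nonneg]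
      exact hx.1 _
    · rw [Finset.sum_sub_distrib, hfeas.2, hx.2, sub_self]
  have e : ∑ n, (a n * w n - τ * b n) * (x n - w n) =
      -(τ * ∑ n, criticalRatio τ p a b (H (κ n)) (H (κ n + 1)) * (w n - x n)) := by
    rw [Finset.mul_sum, ← Finset.sum_neg_distrib]
    refine Finset.sum_congr rfl fun n _ => ?_
    have : a n * w n - τ * b n = τ * criticalRatio τ p a b (H (κ n)) (H (κ n + 1)) := by
      rw [hw _ n (hκ n)]
      field_simp [(ha n).ne']
      ring
    rw [this]
    ring
  rw [e, neg_nonneg]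
  exact mul_nonpos_of_nonneg_of_nonpos hτ'.le key

end Critical


/-! ### A strong law for bounded martingale differences -/

section StrongLaw

variable {Ω : Type*} {mΩ : MeasurableSpace Ω} {μ : Measure Ω} [IsProbabilityMeasure μ]
  {ℱ : Filtration ℕ mΩ} {ξ : ℕ → Ω → ℝ} {C : ℝ}

theorem stronglyMeasurable_sum_range (hm : ∀ t, StronglyMeasurable[ℱ (t + 1)] (ξ t)) (T : ℕ) :
    StronglyMeasurable[ℱ T] (fun ω => ∑ t ∈ Finset.range T, ξ t ω) :=
  Finset.stronglyMeasurable_fun_sum _ fun t ht =>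
    (hm t).mono (ℱ.mono (Finset.mem_range.1 ht))

theorem abs_sum_range_le (hC : ∀ t ω, |ξ t ω| ≤ C) (T : ℕ) (ω : Ω) :
    |∑ t ∈ Finset.range T, ξ t ω| ≤ T * C := by
  refine (Finset.abs_sum_le_sum_abs _ _).trans ?_
  refine (Finset.sum_le_sum fun t _ => hC t ω).trans ?_
  simp

/-- The partial sum up to `T` is known at time `T`, so it is orthogonal to `ξ T` and the second
moments add up. -/
theorem integral_sq_sum_martingaleDifference_le (hm : ∀ t, StronglyMeasurable[ℱ (t + 1)] (ξ t))
    (hC : ∀ t ω, |ξ t ω| ≤ C) (h0 : ∀ t, μ[ξ t | ℱ t] =ᵐ[μ] 0) (T : ℕ) :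
    ∫ ω, (∑ t ∈ Finset.range T, ξ t ω) ^ 2 ∂μ ≤ T * C ^ 2 := by
  have hS := stronglyMeasurable_sum_range hm
  have hSm : ∀ T, StronglyMeasurable (fun ω => ∑ t ∈ Finset.range T, ξ t ω) :=
    fun T => (hS T).mono (ℱ.le T)
  have hξm : ∀ t, StronglyMeasurable (ξ t) := fun t => (hm t).mono (ℱ.le _)
  induction T with
  | zero => simp
  | succ T ih =>
    have hi1 : Integrable (fun ω => (∑ t ∈ Finset.range T, ξ t ω) ^ 2) μ := by
      refine Integrable.of_bound ((hSm T).pow 2).aestronglyMeasurable ((T * C) ^ 2)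
        (ae_of_all _ fun ω => ?_)
      rw [Real.norm_eq_abs, abs_pow]
      exact pow_le_pow_left₀ (abs_nonneg _) (abs_sum_range_le hC T ω) 2
    have hi2 : Integrable (fun ω => (∑ t ∈ Finset.range T, ξ t ω) * ξ T ω) μ := by
      refine Integrable.of_bound ((hSm T).mul (hξm T)).aestronglyMeasurable (T * C * C)
        (ae_of_all _ fun ω => ?_)
      rw [Real.norm_eq_abs, abs_mul]
      exact mul_le_mul (abs_sum_range_le hC T ω) (hC T ω) (abs_nonneg _)
        ((abs_nonneg _).trans (abs_sum_range_le hC T ω))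
    have hi4 : Integrable (ξ T) μ :=
      Integrable.of_bound (hξm T).aestronglyMeasurable C (ae_of_all _ fun ω => hC T ω)
    have hsq : ∀ ω, ξ T ω ^ 2 ≤ C ^ 2 := fun ω => by
      rw [← sq_abs]
      exact pow_le_pow_left₀ (abs_nonneg _) (hC T ω) 2
    have hi3 : Integrable (fun ω => ξ T ω ^ 2) μ := by
      refine Integrable.of_bound ((hξm T).pow 2).aestronglyMeasurable (C ^ 2)
        (ae_of_all _ fun ω => ?_)
      rw [Real.norm_eq_abs, abs_of_nonneg (sq_nonneg _)]
      exact hsq ω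
    have horth : ∫ ω, (∑ t ∈ Finset.range T, ξ t ω) * ξ T ω ∂μ = 0 := by
      have h1 := condExp_mul_of_stronglyMeasurable_left (μ := μ) (hS T) hi2 hi4
      rw [← integral_condExp (ℱ.le T)]
      have h2 : μ[fun ω => (∑ t ∈ Finset.range T, ξ t ω) * ξ T ω | ℱ T] =ᵐ[μ] 0 := by
        refine h1.trans ?_
        filter_upwards [h0 T] with ω hω
        simp [hω]
      rw [integral_congr_ae h2]
      simp
    have e : ∀ ω, (∑ t ∈ Finset.range (T + 1), ξ t ω) ^ 2 =
        (∑ t ∈ Finset.range T, ξ t ω) ^ 2 + 2 * ((∑ t ∈ Finset.range T, ξ t ω) * ξ T ω) +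
          ξ T ω ^ 2 := by
      intro ω
      rw [Finset.sum_range_succ]
      ring
    simp_rw [e]
    have h12 : Integrable (fun ω => (∑ t ∈ Finset.range T, ξ t ω) ^ 2 +
        2 * ((∑ t ∈ Finset.range T, ξ t ω) * ξ T ω)) μ := hi1.add (hi2.const_mul 2)
    rw [integral_add h12 hi3, integral_add hi1 (hi2.const_mul 2), integral_const_mul, horth]
    have h3 : ∫ ω, ξ T ω ^ 2 ∂μ ≤ C ^ 2 := by
      refine (integral_mono hi3 (integrable_const _) hsq).trans ?_
      simp
    push_cast
    linarith

/-- Along squares the second moments of the averages are at most C² / m², which is summable. So the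
squared averages have an almost surely finite sum. -/
theorem tendsto_div_sq_of_martingaleDifference (hm : ∀ t, StronglyMeasurable[ℱ (t + 1)] (ξ t))
    (hC : ∀ t ω, |ξ t ω| ≤ C) (h0 : ∀ t, μ[ξ t | ℱ t] =ᵐ[μ] 0) :
    ∀ᵐ ω ∂μ, Tendsto (fun m : ℕ => (∑ t ∈ Finset.range (m ^ 2), ξ t ω) / ((m ^ 2 : ℕ) : ℝ))
      atTop (𝓝 0) := by
  set g : ℕ → Ω → ℝ := fun m ω =>
    ((∑ t ∈ Finset.range (m ^ 2), ξ t ω) / ((m ^ 2 : ℕ) : ℝ)) ^ 2 with hg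
  have hSm : ∀ T, StronglyMeasurable (fun ω => ∑ t ∈ Finset.range T, ξ t ω) :=
    fun T => (stronglyMeasurable_sum_range hm T).mono (ℱ.le T)
  have hgm : ∀ m, Measurable (g m) := fun m =>
    (((hSm (m ^ 2)).measurable.div_const _).pow_const 2)
  have hint : ∀ m, ∫⁻ ω, ENNReal.ofReal (g m ω) ∂μ ≤ ENNReal.ofReal (C ^ 2 * (1 / (m : ℝ) ^ 2)) := by
    intro m
    rw [← ofReal_integral_eq_lintegral_ofReal]
    · apply ENNReal.ofReal_le_ofReal
      simp only [hg, div_pow, integral_div]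
      have := integral_sq_sum_martingaleDifference_le hm hC h0 (m ^ 2)
      rcases Nat.eq_zero_or_pos m with rfl | hpos
      · simp
      · have hm' : (0 : ℝ) < m := by exact_mod_cast hpos
        rw [div_le_iff₀ (by positivity)]
        refine this.trans_eq ?_
        push_cast
        field_simp
    · refine Integrable.of_bound (hgm m).aestronglyMeasurable (C ^ 2) (ae_of_all _ fun ω => ?_)
      rw [Real.norm_eq_abs, abs_pow]
      refine pow_le_pow_left₀ (abs_nonneg _) ?_ 2
      have hC0 : 0 ≤ C := (abs_nonneg _).trans (hC 0 ω)
      rw [abs_div, Nat.abs_cast]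
      refine div_le_of_le_mul₀ (Nat.cast_nonneg _) hC0 ?_
      rw [mul_comm]
      exact abs_sum_range_le hC _ ω
    · exact ae_of_all _ fun ω => sq_nonneg _
  have hsum : Summable (fun m : ℕ => C ^ 2 * (1 / (m : ℝ) ^ 2)) :=
    (Real.summable_one_div_nat_pow.2 one_lt_two).mul_left _
  have hfin : ∫⁻ ω, ∑' m, ENNReal.ofReal (g m ω) ∂μ ≠ ⊤ := by
    rw [lintegral_tsum fun m => (hgm m).ennreal_ofReal.aemeasurable]
    refine ne_top_of_le_ne_top ?_ (ENNReal.tsum_le_tsum hint)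
    rw [← ENNReal.ofReal_tsum_of_nonneg (fun m => by positivity) hsum]
    exact ENNReal.ofReal_ne_top
  filter_upwards [ae_lt_top (Measurable.tsum fun m => (hgm m).ennreal_ofReal) hfin]
    with ω hω
  have h1 := ENNReal.tendsto_atTop_zero_of_tsum_ne_top hω.ne
  have h2 := (ENNReal.tendsto_toReal ENNReal.zero_ne_top).comp h1
  have h3 : Tendsto (fun m => g m ω) atTop (𝓝 0) := by
    refine Tendsto.congr (fun m => ?_) h2
    exact ENNReal.toReal_ofReal (sq_nonneg _)
  have h4 := (Real.continuous_sqrt.tendsto 0).comp h3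
  rw [Real.sqrt_zero] at h4
  refine squeeze_zero_norm (fun m => ?_) h4
  simp only [hg, Function.comp_apply, Real.sqrt_sq_eq_abs, Real.norm_eq_abs, le_refl]

/-- Adding `C` to each term makes the partial sums monotone. Convergence along squares then
interpolates, as ratios of consecutive squares tend to 1. -/
theorem tendsto_div_of_martingaleDifference (hm : ∀ t, StronglyMeasurable[ℱ (t + 1)] (ξ t))
    (hC : ∀ t ω, |ξ t ω| ≤ C) (h0 : ∀ t, μ[ξ t | ℱ t] =ᵐ[μ] 0) :
    ∀ᵐ ω ∂μ, Tendsto (fun T : ℕ => (∑ t ∈ Finset.range T, ξ t ω) / T) atTop (𝓝 0) := by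
  filter_upwards [tendsto_div_sq_of_martingaleDifference hm hC h0] with ω hω
  have hmono : Monotone (fun T : ℕ => ∑ t ∈ Finset.range T, (ξ t ω + C)) := by
    refine monotone_nat_of_le_succ fun T => ?_
    rw [Finset.sum_range_succ]
    linarith [(abs_le.1 (hC T ω)).1]
  have hquot : ∀ T : ℕ, T ≠ 0 → (∑ t ∈ Finset.range T, (ξ t ω + C)) / (T : ℝ) =
      (∑ t ∈ Finset.range T, ξ t ω) / T + C := by
    intro T hT
    have : (T : ℝ) ≠ 0 := by exact_mod_cast hT
    rw [Finset.sum_add_distrib]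
    simp only [Finset.sum_const, Finset.card_range, nsmul_eq_mul]
    field_simp
  have hlim := tendsto_div_of_monotone_of_exists_subseq_tendsto_div
    (fun T : ℕ => ∑ t ∈ Finset.range T, (ξ t ω + C)) C hmono (fun α hα => ?_)
  · have := hlim.sub_const C
    rw [sub_self] at this
    refine this.congr' ?_
    filter_upwards [eventually_ne_atTop 0] with T hT
    rw [hquot T hT, add_sub_cancel_right]
  · refine ⟨fun m => m ^ 2, ?_, tendsto_pow_atTop two_ne_zero, ?_⟩
    · have h1 : Tendsto (fun m : ℕ => (1 + 1 / (m : ℝ)) ^ 2) atTop (𝓝 1) := by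
        have := (tendsto_one_div_atTop_nhds_zero_nat (𝕜 := ℝ)).const_add 1
        simpa using this.pow 2
      filter_upwards [h1.eventually (ge_mem_nhds hα), eventually_gt_atTop 0] with m hle hpos
      have hm' : (0 : ℝ) < m := by exact_mod_cast hpos
      have := mul_le_mul_of_nonneg_right hle (sq_nonneg (m : ℝ))
      refine le_of_eq_of_le ?_ (this.trans_eq ?_)
      · push_cast
        field_simp
      · push_cast
        rfl
    · have := hω.add_const C
      rw [zero_add] at this
      refine this.congr' ?_
      filter_upwards [eventually_ne_atTop 0] with m hm0
      exact (hquot (m ^ 2) (pow_ne_zero 2 hm0)).symm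

end StrongLaw

/-! ### A deterministic convergence criterion -/

/-- `V K` is at most the sum of `g k` for `k < K`, hence at most `K` times the sum of |g k / (k +
1)|. After division by K² this is a Cesàro mean of a null sequence. -/
theorem tendsto_div_sq_of_increment_le {V g : ℕ → ℝ} (hV0 : V 0 = 0) (hV : ∀ k, 0 ≤ V k)
    (hstep : ∀ k, V (k + 1) ≤ V k + g k)
    (hg : Tendsto (fun k : ℕ => g k / ((k : ℝ) + 1)) atTop (𝓝 0)) :
    Tendsto (fun k : ℕ => V k / (k : ℝ) ^ 2) atTop (𝓝 0) := by
  have h1 : Tendsto (fun k : ℕ => |g k / ((k : ℝ) + 1)|) atTop (𝓝 0) := by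
    simpa using hg.abs
  have h2 : ∀ K : ℕ, V K ≤ K * ∑ k ∈ Finset.range K, |g k / ((k : ℝ) + 1)| := by
    intro K
    have h3 : V K ≤ ∑ k ∈ Finset.range K, g k := by
      induction K with
      | zero => simp [hV0]
      | succ K ih =>
        rw [Finset.sum_range_succ]
        linarith [hstep K]
    refine h3.trans ?_
    rw [Finset.mul_sum]
    refine Finset.sum_le_sum fun k hk => ?_
    have hk1 : (k : ℝ) + 1 ≤ K := by exact_mod_cast Finset.mem_range.1 hk
    have hk0 : (0 : ℝ) < (k : ℝ) + 1 := by positivity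
    calc g k = ((k : ℝ) + 1) * (g k / ((k : ℝ) + 1)) := by field_simp
      _ ≤ ((k : ℝ) + 1) * |g k / ((k : ℝ) + 1)| :=
        mul_le_mul_of_nonneg_left (le_abs_self _) hk0.le
      _ ≤ K * |g k / ((k : ℝ) + 1)| := mul_le_mul_of_nonneg_right hk1 (abs_nonneg _)
  refine squeeze_zero (fun k => div_nonneg (hV k) (sq_nonneg _)) (fun K => ?_) h1.cesaro
  rcases Nat.eq_zero_or_pos K with rfl | hK
  · simp
  · have hK' : (0 : ℝ) < K := by exact_mod_cast hK
    rw [div_le_iff₀ (by positivity)]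
    refine (h2 K).trans_eq ?_
    field_simp

/-- If the drift `f k` points towards `w` up to sublinear errors, the averages converge to `w`. -/
theorem tendsto_div_of_drift {ι : Type*} [Fintype ι] {a w : ι → ℝ} (ha : ∀ n, 0 < a n)
    {u f : ℕ → ι → ℝ} {C : ℝ} (hf : ∀ k n, |f k n - w n| ≤ C)
    (herr : ∀ n, Tendsto (fun k : ℕ => (u k n - ∑ j ∈ Finset.range k, f j n) / k) atTop (𝓝 0))
    (hdrift : ∀ k : ℕ, ∑ n, a n * (u k n - k * w n) * (f k n - w n) ≤ 0) (n : ι) :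
    Tendsto (fun k : ℕ => u k n / k) atTop (𝓝 (w n)) := by
  -- The Lyapunov function is built on the predictable part `e`, not on `u - k w`: its increments
  -- are bounded by `C`, and the noise `Ξ` enters only the cross term, linearly.
  set e : ℕ → ι → ℝ := fun k n => ∑ j ∈ Finset.range k, (f j n - w n) with he
  set Ξ : ℕ → ι → ℝ := fun k n => u k n - ∑ j ∈ Finset.range k, f j n with hΞ
  have heu : ∀ k n, u k n - k * w n = e k n + Ξ k n := by
    intro k n
    simp only [he, hΞ, Finset.sum_sub_distrib, Finset.sum_const, Finset.card_range, nsmul_eq_mul]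
    ring
  have hV : Tendsto (fun k : ℕ => (∑ n, a n * e k n ^ 2) / (k : ℝ) ^ 2) atTop (𝓝 0) := by
    refine tendsto_div_sq_of_increment_le (V := fun k => ∑ n, a n * e k n ^ 2)
      (g := fun k => ∑ n, a n * (2 * (|Ξ k n| * C) + C ^ 2)) ?_ ?_ ?_ ?_
    · simp [he]
    · exact fun k => Finset.sum_nonneg fun n _ => mul_nonneg (ha n).le (sq_nonneg _)
    · intro k
      have h1 : ∑ n, a n * e (k + 1) n ^ 2 = ∑ n, a n * e k n ^ 2 +
          2 * ∑ n, a n * (u k n - k * w n) * (f k n - w n) +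
          ∑ n, a n * (2 * (-Ξ k n * (f k n - w n)) + (f k n - w n) ^ 2) := by
        rw [Finset.mul_sum, ← Finset.sum_add_distrib, ← Finset.sum_add_distrib]
        refine Finset.sum_congr rfl fun n _ => ?_
        rw [heu]
        simp only [he, Finset.sum_range_succ]
        ring
      have h2 : ∑ n, a n * (2 * (-Ξ k n * (f k n - w n)) + (f k n - w n) ^ 2) ≤
          ∑ n, a n * (2 * (|Ξ k n| * C) + C ^ 2) := by
        refine Finset.sum_le_sum fun n _ => mul_le_mul_of_nonneg_left ?_ (ha n).le
        have h3 : -Ξ k n * (f k n - w n) ≤ |Ξ k n| * C := by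
          refine (le_abs_self _).trans ?_
          rw [abs_mul, abs_neg]
          exact mul_le_mul_of_nonneg_left (hf k n) (abs_nonneg _)
        have h4 : (f k n - w n) ^ 2 ≤ C ^ 2 := by
          rw [← sq_abs]
          exact pow_le_pow_left₀ (abs_nonneg _) (hf k n) 2
        linarith
      linarith [hdrift k]
    · have hinv : Tendsto (fun k : ℕ => 1 / ((k : ℝ) + 1)) atTop (𝓝 0) :=
        tendsto_one_div_add_atTop_nhds_zero_nat
      have hΞ1 : ∀ n, Tendsto (fun k : ℕ => |Ξ k n| * (1 / ((k : ℝ) + 1))) atTop (𝓝 0) := by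
        intro n
        have h1 : Tendsto (fun k : ℕ => |Ξ k n / k|) atTop (𝓝 0) := by
          simpa using (herr n).abs
        refine squeeze_zero' (Eventually.of_forall fun k => by positivity) ?_ h1
        filter_upwards [eventually_gt_atTop 0] with k hk
        have hk' : (0 : ℝ) < k := by exact_mod_cast hk
        rw [abs_div, abs_of_pos hk', div_eq_mul_one_div |Ξ k n|]
        exact mul_le_mul_of_nonneg_left
          (one_div_le_one_div_of_le hk' (by linarith)) (abs_nonneg _)
      have hsum : Tendsto (fun k : ℕ => ∑ n, a n * (2 * C * (|Ξ k n| * (1 / ((k : ℝ) + 1))) +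
          C ^ 2 * (1 / ((k : ℝ) + 1)))) atTop (𝓝 (∑ n, a n * (2 * C * 0 + C ^ 2 * 0))) :=
        tendsto_finsetSum _ fun n _ =>
          (((hΞ1 n).const_mul _).add (hinv.const_mul _)).const_mul _
      simp only [mul_zero, add_zero, Finset.sum_const_zero] at hsum
      refine hsum.congr fun k => ?_
      rw [Finset.sum_div]
      exact Finset.sum_congr rfl fun n _ => by ring
  have hen : Tendsto (fun k : ℕ => e k n / k) atTop (𝓝 0) := by
    have h1 : Tendsto (fun k : ℕ => Real.sqrt
        ((1 / a n) * ((∑ n, a n * e k n ^ 2) / (k : ℝ) ^ 2))) atTop (𝓝 0) := by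
      have := (Real.continuous_sqrt.tendsto _).comp (hV.const_mul (1 / a n))
      rwa [mul_zero, Real.sqrt_zero] at this
    refine squeeze_zero_norm (fun k => ?_) h1
    rw [Real.norm_eq_abs]
    refine Real.abs_le_sqrt ?_
    rw [div_pow, ← mul_div_assoc]
    refine div_le_div_of_nonneg_right ?_ (sq_nonneg _)
    rw [one_div, le_inv_mul_iff₀ (ha n)]
    exact Finset.single_le_sum (f := fun n => a n * e k n ^ 2)
      (fun n _ => mul_nonneg (ha n).le (sq_nonneg _)) (Finset.mem_univ n)
  have := (hen.add (herr n)).add_const (w n)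
  rw [add_zero, zero_add] at this
  refine this.congr' ?_
  filter_upwards [eventually_gt_atTop 0] with k hk
  have hk' : (k : ℝ) ≠ 0 := by exact_mod_cast hk.ne'
  rw [← add_div]
  change (e k n + Ξ k n) / (k : ℝ) + w n = _
  rw [← heu]
  field_simp
  ring


/-! ### Decomposition of one period into slot noises -/

/-- Centered outcome of one slot with pending set `U`, weighted by the change of `ψ`. -/
noncomputable def slotNoise (p : Fin N → ℝ) (r : Equiv.Perm (Fin N)) (ψ : Finset (Fin N) → ℝ)
    (U : Finset (Fin N)) (o : Fin N → Bool) (m : Fin N) : ℝ :=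
  (if Served r U m then ψ (U.erase m) - ψ U else 0) * ((if o m = true then 1 else 0) - p m)

theorem sum_slotNoise (p : Fin N → ℝ) (r : Equiv.Perm (Fin N)) (ψ : Finset (Fin N) → ℝ)
    (U : Finset (Fin N)) (o : Fin N → Bool) : ∑ m, slotNoise p r ψ U o m =
      ψ (nextPending r U o) - ψ U -
        ∑ m, if Served r U m then p m * (ψ (U.erase m) - ψ U) else 0 := by
  rw [apply_nextPending r U o ψ, add_sub_cancel_left, ← Finset.sum_sub_distrib]
  refine Finset.sum_congr rfl fun m _ => ?_
  unfold slotNoise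
  split_ifs <;> ring

/-- Work done so far plus expected work in the remaining slots is a martingale; its increments
telescope. After slot `s` there remain `τ - 1 - s` slots. -/
theorem workSlots_sub_meanWork (p : Fin N → ℝ) (τ : ℕ) (r : Equiv.Perm (Fin N))
    (x : ℕ → Fin N → Bool) (n : Fin N) (S : Finset (Fin N)) :
    (workSlots τ r S x n : ℝ) - meanWork p r n τ S = ∑ s ∈ Finset.range τ, ∑ m,
      slotNoise p r (meanWork p r n (τ - 1 - s)) (pending r S x s) (x s) m := by
  have h1 : ∀ s ∈ Finset.range τ, ∑ m,
      slotNoise p r (meanWork p r n (τ - 1 - s)) (pending r S x s) (x s) m =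
      (if Served r (pending r S x s) n then 1 else 0) +
        (meanWork p r n (τ - (s + 1)) (pending r S x (s + 1)) -
          meanWork p r n (τ - s) (pending r S x s)) := by
    intro s hs
    have hs' := Finset.mem_range.1 hs
    obtain ⟨d, rfl⟩ : ∃ d, τ = s + 1 + d := ⟨τ - (s + 1), by omega⟩
    rw [sum_slotNoise, ← pending_succ, show s + 1 + d - 1 - s = d by omega,
      show s + 1 + d - (s + 1) = d by omega, show s + 1 + d - s = d + 1 by omega]
    simp only [meanWork, expectedReward]
    ring
  rw [Finset.sum_congr rfl h1, Finset.sum_add_distrib,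
    Finset.sum_range_sub (fun s => meanWork p r n (τ - s) (pending r S x s)), workSlots,
    Finset.card_filter]
  simp [meanWork, expectedReward, pending, sub_eq_add_neg]

/-- The delivery indicator can jump only in a slot spent on `n`, and then with probability `p n`; so
`p n` times the work is its compensator. -/
theorem delivered_sub_workSlots (p : Fin N → ℝ) (τ : ℕ) (r : Equiv.Perm (Fin N))
    (x : ℕ → Fin N → Bool) (n : Fin N) :
    (if n ∉ pending r Finset.univ x τ then 1 else 0) -
      p n * (workSlots τ r Finset.univ x n : ℝ) = ∑ s ∈ Finset.range τ, ∑ m,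
        slotNoise p r (fun U => if n ∉ U then 1 else 0) (pending r Finset.univ x s) (x s) m := by
  have h1 : ∀ s, ∑ m, slotNoise p r (fun U => if n ∉ U then 1 else 0)
      (pending r Finset.univ x s) (x s) m =
      ((if n ∉ pending r Finset.univ x (s + 1) then 1 else 0) -
        (if n ∉ pending r Finset.univ x s then 1 else 0)) -
      p n * (if Served r (pending r Finset.univ x s) n then 1 else 0) := by
    intro s
    rw [sum_slotNoise, ← pending_succ, Finset.sum_eq_single n]
    · congr 1
      by_cases h : Served r (pending r Finset.univ x s) n
      · simp [h.1]
      · simp only [h, if_false, mul_zero]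
    · intro m _ hmn
      simp [hmn.symm]
    · simp
  simp_rw [h1]
  rw [Finset.sum_sub_distrib, Finset.sum_range_sub
    (fun s => if n ∉ pending r Finset.univ x s then (1 : ℝ) else 0), ← Finset.mul_sum, workSlots,
    Finset.card_filter]
  simp [pending]

/-! ### Vanishing of the averaged noise -/

theorem sum_range_mul_eq (f : ℕ → ℕ → ℝ) (hτ : 0 < τ) (K : ℕ) :
    ∑ t ∈ Finset.range (K * τ), f (t / τ) (t % τ) =
      ∑ k ∈ Finset.range K, ∑ s ∈ Finset.range τ, f k s := by
  induction K with
  | zero => simp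
  | succ K ih =>
    rw [Nat.succ_mul, Finset.sum_range_add, ih, Finset.sum_range_succ]
    congr 1
    refine Finset.sum_congr rfl fun s hs => ?_
    have hs' := Finset.mem_range.1 hs
    rw [mul_comm K τ, Nat.mul_add_div hτ, Nat.div_eq_of_lt hs', Nat.mul_add_mod,
      Nat.mod_eq_of_lt hs', add_zero]

section Channel

variable {Ω : Type*} {mΩ : MeasurableSpace Ω} {μ : Measure Ω} {ℱ : Filtration ℕ mΩ}
  {p : Fin N → ℝ} {X : ℕ → Fin N → Ω → Bool} {r : ℕ → Ω → Equiv.Perm (Fin N)} {τ : ℕ}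

theorem IsChannel.measurable_outcome (hX : IsChannel μ ℱ p X) (t : ℕ) (n : Fin N) :
    Measurable[ℱ (t + 1)] (fun ω => if X t n ω = true then (1 : ℝ) else 0) :=
  Measurable.ite (hX.measurableSet_success t n) measurable_const measurable_const

/-- Stated for all real functions `F` of the pending set because the increment of `F` over a slot
involves another such function. -/
theorem IsChannel.measurable_pending (hX : IsChannel μ ℱ p X) (ρ : Equiv.Perm (Fin N))
    (k s : ℕ) (F : Finset (Fin N) → ℝ) : Measurable[ℱ (k * τ + s)] (fun ω =>
      F (pending ρ Finset.univ (periodChannel τ (fun t n => X t n ω) k) s)) := by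
  induction s generalizing F with
  | zero =>
    simp only [pending]
    exact measurable_const
  | succ s ih =>
    have e : ∀ ω, F (pending ρ Finset.univ (periodChannel τ (fun t n => X t n ω) k) (s + 1)) =
        F (pending ρ Finset.univ (periodChannel τ (fun t n => X t n ω) k) s) +
        ∑ m, (fun U => if Served ρ U m then F (U.erase m) - F U else 0)
          (pending ρ Finset.univ (periodChannel τ (fun t n => X t n ω) k) s) *
          (if X (k * τ + s) m ω = true then (1 : ℝ) else 0) := by
      intro ω
      rw [pending_succ, apply_nextPending _ _ _ F]
      congr 1
      refine Finset.sum_congr rfl fun m _ => ?_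
      by_cases h : X (k * τ + s) m ω = true <;> simp [periodChannel, h]
    simp_rw [e]
    have hle : ℱ (k * τ + s) ≤ ℱ (k * τ + (s + 1)) := ℱ.mono (by omega)
    refine ((ih F).mono hle le_rfl).add (Finset.measurable_sum _ fun m _ => ?_)
    exact ((ih fun U => if Served ρ U m then F (U.erase m) - F U else 0).mono hle le_rfl).mul
      (hX.measurable_outcome _ m)

theorem IsChannel.measurable_order_pending (hX : IsChannel μ ℱ p X)
    (hr : ∀ k s, MeasurableSet[ℱ (k * τ)] {ω | r k ω = s})
    (k s : ℕ) (F : Equiv.Perm (Fin N) → Finset (Fin N) → ℝ) :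
    Measurable[ℱ (k * τ + s)] (fun ω =>
      F (r k ω) (pending (r k ω) Finset.univ (periodChannel τ (fun t n => X t n ω) k) s)) := by
  have e : ∀ ω, F (r k ω)
      (pending (r k ω) Finset.univ (periodChannel τ (fun t n => X t n ω) k) s) =
      ∑ ρ, if r k ω = ρ then
        F ρ (pending ρ Finset.univ (periodChannel τ (fun t n => X t n ω) k) s) else 0 := by
    intro ω
    simp
  simp_rw [e]
  refine Finset.measurable_sum _ fun ρ _ => ?_
  exact Measurable.ite (ℱ.mono (Nat.le_add_right _ _) _ (hr k ρ))
    (hX.measurable_pending ρ k s (F ρ)) measurable_const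

/-- For fixed `m`, the noise of slot `t` is a bounded coefficient known at time `t` times a centered
outcome, hence a martingale difference. The strong law is applied along `T = K * τ`. -/
theorem IsChannel.tendsto_slotNoise [IsProbabilityMeasure μ] (hX : IsChannel μ ℱ p X) (hτ : 0 < τ)
    (hp0 : ∀ n, 0 ≤ p n) (hp1 : ∀ n, p n ≤ 1)
    (hr : ∀ k s, MeasurableSet[ℱ (k * τ)] {ω | r k ω = s})
    (ψ : Equiv.Perm (Fin N) → ℕ → Finset (Fin N) → ℝ) {C : ℝ}
    (hψ : ∀ ρ s U, ψ ρ s U ∈ Set.Icc 0 C) :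
    ∀ᵐ ω ∂μ, Tendsto (fun K : ℕ => (∑ k ∈ Finset.range K, ∑ s ∈ Finset.range τ, ∑ m,
      slotNoise p (r k ω) (ψ (r k ω) s)
        (pending (r k ω) Finset.univ (periodChannel τ (fun t n => X t n ω) k) s)
        (periodChannel τ (fun t n => X t n ω) k s) m) / K) atTop (𝓝 0) := by
  have hC : 0 ≤ C := (hψ (Equiv.refl _) 0 ∅).1.trans (hψ (Equiv.refl _) 0 ∅).2
  set Δ : Fin N → ℕ → Equiv.Perm (Fin N) → Finset (Fin N) → ℝ := fun m s ρ U =>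
    if Served ρ U m then ψ ρ s (U.erase m) - ψ ρ s U else 0 with hΔ
  have hΔC : ∀ m s ρ U, |Δ m s ρ U| ≤ C := by
    intro m s ρ U
    simp only [hΔ]
    split_ifs
    · have h1 := hψ ρ s (U.erase m)
      have h2 := hψ ρ s U
      rw [abs_le]
      exact ⟨by linarith [h1.1, h2.2], by linarith [h1.2, h2.1]⟩
    · simpa using hC
  set c : Fin N → ℕ → Ω → ℝ := fun m t ω => Δ m (t % τ) (r (t / τ) ω)
    (pending (r (t / τ) ω) Finset.univ (periodChannel τ (fun t n => X t n ω) (t / τ)) (t % τ))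
    with hc
  set η : Fin N → ℕ → Ω → ℝ := fun m t ω => (if X t m ω = true then (1 : ℝ) else 0) - p m with hη
  have hcm : ∀ m t, Measurable[ℱ t] (c m t) := by
    intro m t
    have := hX.measurable_order_pending hr (t / τ) (t % τ) (Δ m (t % τ))
    rwa [Nat.div_add_mod'] at this
  have hηm : ∀ m t, Measurable[ℱ (t + 1)] (η m t) :=
    fun m t => (hX.measurable_outcome t m).sub_const _
  have hη1 : ∀ m t ω, |η m t ω| ≤ 1 := by
    intro m t ω
    have h0 := hp0 m
    have h1 := hp1 m
    simp only [hη]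
    rw [abs_le]
    split_ifs <;> constructor <;> linarith
  have hξC : ∀ m t ω, |c m t ω * η m t ω| ≤ C := by
    intro m t ω
    rw [abs_mul]
    exact (mul_le_mul (hΔC _ _ _ _) (hη1 m t ω) (abs_nonneg _) hC).trans_eq (mul_one C)
  have hξm : ∀ m t, Measurable[ℱ (t + 1)] (fun ω => c m t ω * η m t ω) :=
    fun m t => ((hcm m t).mono (ℱ.mono t.le_succ) le_rfl).mul (hηm m t)
  have hη0 : ∀ m t, μ[η m t | ℱ t] =ᵐ[μ] 0 := by
    intro m t
    have hs : MeasurableSet {ω | X t m ω = true} := ℱ.le _ _ (hX.measurableSet_success t m)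
    have e : η m t = {ω | X t m ω = true}.indicator (fun _ => (1 : ℝ)) - fun _ => p m := by
      ext ω
      simp [hη, Set.indicator_apply]
    rw [e]
    refine (condExp_sub ((integrable_const _).indicator hs) (integrable_const _) _).trans ?_
    filter_upwards [hX.condProb_success t m] with ω hω
    rw [Pi.sub_apply, hω, condExp_const (ℱ.le t)]
    simp
  have hξ0 : ∀ m t, μ[fun ω => c m t ω * η m t ω | ℱ t] =ᵐ[μ] 0 := by
    intro m t
    have hi1 : Integrable (fun ω => c m t ω * η m t ω) μ :=
      Integrable.of_bound ((hξm m t).mono (ℱ.le _) le_rfl).aestronglyMeasurable C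
        (ae_of_all _ fun ω => hξC m t ω)
    have hi2 : Integrable (η m t) μ :=
      Integrable.of_bound ((hηm m t).mono (ℱ.le _) le_rfl).aestronglyMeasurable 1
        (ae_of_all _ fun ω => hη1 m t ω)
    refine (condExp_mul_of_stronglyMeasurable_left (hcm m t).stronglyMeasurable hi1 hi2).trans ?_
    filter_upwards [hη0 m t] with ω hω
    simp [hω]
  have hlim := ae_all_iff.2 fun m => tendsto_div_of_martingaleDifference
    (fun t => (hξm m t).stronglyMeasurable) (hξC m) (hξ0 m)
  filter_upwards [hlim] with ω hω
  have h1 : Tendsto (fun K : ℕ => K * τ) atTop atTop :=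
    tendsto_id.atTop_mul_const' hτ
  have h2 := (tendsto_finsetSum Finset.univ fun m _ => (hω m).comp h1).mul_const (τ : ℝ)
  simp only [Finset.sum_const_zero, zero_mul] at h2
  refine h2.congr fun K => ?_
  have hτ' : (τ : ℝ) ≠ 0 := by exact_mod_cast hτ.ne'
  have h3 : ∀ m, ∑ t ∈ Finset.range (K * τ), c m t ω * η m t ω =
      ∑ k ∈ Finset.range K, ∑ s ∈ Finset.range τ, slotNoise p (r k ω) (ψ (r k ω) s)
        (pending (r k ω) Finset.univ (periodChannel τ (fun t n => X t n ω) k) s)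
        (periodChannel τ (fun t n => X t n ω) k s) m := by
    intro m
    rw [← sum_range_mul_eq _ hτ]
    refine Finset.sum_congr rfl fun t _ => ?_
    simp only [hc, hη, hΔ, slotNoise, periodChannel, Nat.div_add_mod']
  simp only [Function.comp_apply, h3]
  rw [← Finset.sum_div, Finset.sum_comm]
  simp_rw [Finset.sum_comm (s := (Finset.univ : Finset (Fin N)))]
  push_cast
  field_simp

end Channel

end DelayQoS

open DelayQoS
theorem mainTheorem7 {N : ℕ} (τ : ℕ) (hτ : 0 < τ)
    (p : Fin N → ℝ) (hp0 : ∀ n, 0 < p n) (hp1 : ∀ n, p n ≤ 1)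
    (a b : Fin N → ℝ) (ha : ∀ n, 0 < a n) (hb : ∀ n, 0 ≤ b n) :
    ∃ q : Fin N → ℝ,
      -- the explicit description of `q`, which does not depend on the choice of the sets `H k`
      (∃ H, IsCriticalSequence τ p a b H) ∧
      (∀ H, IsCriticalSequence τ p a b H →
        (∀ n, ∃ k, n ∈ H (k + 1) \ H k) ∧
        ∀ k, ∀ n ∈ H (k + 1) \ H k,
          q n = τ * p n * ((b n + criticalRatio τ p a b (H k) (H (k + 1))) / a n)) ∧
      -- almost sure convergence of the delivery ratios under every such policy
      ∀ {Ω : Type*} {mΩ : MeasurableSpace Ω} (μ : Measure Ω) [IsProbabilityMeasure μ]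
        (ℱ : Filtration ℕ mΩ) (X : ℕ → Fin N → Ω → Bool) (r : ℕ → Ω → Equiv.Perm (Fin N)),
        IsChannel μ ℱ p X →
        (∀ k s, MeasurableSet[ℱ (k * τ)] {ω | r k ω = s}) →
        (∀ ω, IsGeneralizedTransmissionTime τ a b (fun k => r k ω) (fun t n => X t n ω)) →
        ∀ᵐ ω ∂μ, Tendsto
          (fun K => deliveryRatio τ (fun k => r k ω) (fun t n => X t n ω) K) atTop (𝓝 q) := by
  have hp0' : ∀ n, 0 ≤ p n := fun n => (hp0 n).le
  have hrate : ∀ H, IsCriticalSequence τ p a b H → ∃ w, IsBalanced τ p a b w ∧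
      ∀ k, ∀ n ∈ H (k + 1) \ H k,
        w n = τ * ((b n + criticalRatio τ p a b (H k) (H (k + 1))) / a n) := by
    intro H hH
    choose κ hκ using hH.exists_mem_sdiff
    refine ⟨fun n => τ * ((b n + criticalRatio τ p a b (H (κ n)) (H (κ n + 1))) / a n), ?_, ?_⟩
    · refine hH.isBalanced hτ ha hp0' hp1 fun k n hn => ?_
      rw [hH.index_unique hn (hκ n)]
    · intro k n hn
      rw [hH.index_unique hn (hκ n)]
  obtain ⟨H₀, hH₀⟩ := exists_isCriticalSequence τ p a b
  obtain ⟨w, hw, -⟩ := hrate H₀ hH₀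
  refine ⟨fun n => p n * w n, ⟨H₀, hH₀⟩, fun H hH => ⟨hH.exists_mem_sdiff, fun k n hn => ?_⟩, ?_⟩
  · obtain ⟨w', hw', hw'H⟩ := hrate H hH
    -- By uniqueness, the rates from any critical sequence coincide with those from `H₀`.
    simp only [hw.unique ha hw', hw'H k n hn]
    ring
  intro Ω mΩ μ _ ℱ X r hX hr hpolicy
  have hbound : ∀ n (ρ : Equiv.Perm (Fin N)) (s : ℕ) U,
      meanWork p ρ n s U ∈ Set.Icc (0 : ℝ) s := by
    refine fun n ρ s U => expectedReward_mem_Icc hp0' hp1 ρ (fun V => ?_) s U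
    split_ifs <;> simp
  have hwork := ae_all_iff.2 fun n => hX.tendsto_slotNoise hτ hp0' hp1 hr
    (fun ρ s => meanWork p ρ n (τ - 1 - s)) (C := τ) fun ρ s U =>
      ⟨(hbound n ρ _ U).1, (hbound n ρ _ U).2.trans (by exact_mod_cast (by omega))⟩
  have hdel := ae_all_iff.2 fun n => hX.tendsto_slotNoise hτ hp0' hp1 hr
    (fun _ _ U => if n ∉ U then (1 : ℝ) else 0) (C := 1) fun ρ s U => by split_ifs <;> simp
  filter_upwards [hwork, hdel] with ω hω1 hω2
  simp only [← workSlots_sub_meanWork, ← delivered_sub_workSlots] at hω1 hω2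
  set x : ℕ → ℕ → Fin N → Bool := fun k => periodChannel τ (fun t n => X t n ω) k with hx
  have halloc : ∀ (k : ℕ) (n : Fin N),
      (allocated τ (fun k => r k ω) (fun t n => X t n ω) k n : ℝ) =
        ∑ j ∈ Finset.range k, (workSlots τ (r j ω) Finset.univ (x j) n : ℝ) := by
    intro k n
    simp [allocated, hx]
  obtain ⟨C, hC⟩ : ∃ C : ℝ, ∀ n, τ + |w n| ≤ C := by
    obtain ⟨C, hC⟩ := (Set.finite_range fun n => (τ : ℝ) + |w n|).bddAbove
    exact ⟨C, fun n => hC ⟨n, rfl⟩⟩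
  have hu : ∀ n, Tendsto (fun k : ℕ =>
      (allocated τ (fun k => r k ω) (fun t n => X t n ω) k n : ℝ) / k) atTop (𝓝 (w n)) := by
    refine tendsto_div_of_drift
      (u := fun k n => (allocated τ (fun k => r k ω) (fun t n => X t n ω) k n : ℝ))
      (f := fun k n => meanWork p (r k ω) n τ Finset.univ) (C := C) ha ?_ ?_ ?_
    · intro k n
      have h1 := hbound n (r k ω) τ Finset.univ
      refine (abs_sub _ _).trans ((add_le_add_left ?_ _).trans (hC n))
      rw [abs_of_nonneg h1.1]
      exact h1.2
    · intro n
      refine (hω1 n).congr fun k => ?_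
      rw [halloc, Finset.sum_sub_distrib]
    · intro k
      -- The drift splits through a (u - k w) = (a u - b k τ) - k (a w - τ b). The greedy property
      -- controls the first term, the variational inequality the second.
      have h1 := sum_mul_meanWork_sub_nonpos hp0' hp1 hw.1
        (fun n => a n * (allocated τ (fun k => r k ω) (fun t n => X t n ω) k n : ℝ) -
          b n * ((k * τ : ℕ) : ℝ)) (r k ω) (hpolicy ω k)
      have h2 := mul_nonneg (Nat.cast_nonneg (α := ℝ) k)
        (hw.2 _ (isFeasible_meanWork hp0' hp1 τ (r k ω)))
      rw [← sub_nonpos] at h1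
      have h3 := sub_nonpos.2 ((sub_nonpos.1 h1).trans h2)
      rw [Finset.mul_sum, ← Finset.sum_sub_distrib] at h3
      refine le_of_eq_of_le (Finset.sum_congr rfl fun n _ => ?_) h3
      push_cast
      ring
  rw [tendsto_pi_nhds]
  intro n
  -- Delivery ratio = averaged delivery noise + `p n` times the average work.
  have h1 := (hω2 n).add ((hu n).const_mul (p n))
  rw [zero_add] at h1
  refine h1.congr fun K => ?_
  rw [halloc, deliveryRatio, Finset.sum_sub_distrib, ← Finset.mul_sum, Finset.card_filter]
  push_cast
  ring
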